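/- Let $R=\begin{pmatrix}a&b\\c&d\end{pmatrix}$ have nonnegative integer entries with $b\neq 0$, $c\neq 0$ and constant row sum $S=a+b=c+d$; put $m=a-c=d-b$ and $\sigma=m/S$, and assume $\sigma>\tfrac12$. For $(\alpha,\beta)\in\{(1,0),(0,1)\}$ let $(U_{(\alpha,\beta)}(n))_{n\ge 0}$ be the discrete-time two-colour Pólya urn process with replacement matrix $R$ started from $\alpha$ red and $\beta$ black balls: it is the $\mathbb N^2$-valued Markov chain with $U_{(\alpha,\beta)}(0)=(\alpha,\beta)$ that moves from $(x,y)$ to $(x+a,y+b)$ with probability $\frac{x}{x+y}$ (a red ball is drawn) and to $(x+c,y+d)$ with probability $\frac{y}{x+y}$ (a black ball is drawn). Let $u_2(x,y)=\frac1S(bx-cy)$. Then the limits $$X=\lim_{n\to\infty}\frac{u_2\big(U_{(1,0)}(n)\big)}{n^{\sigma}},\qquad Y=\lim_{n\to\infty}\frac{u_2\big(U_{(0,1)}(n)\big)}{n^{\sigma}}$$ exist almost surely in $\mathbb R$, and they satisfy the system of equations in distribution $$X\overset{\mathcal L}{=}\sum_{k=1}^{a+1}V_k^{\sigma}X^{(k)}+\sum_{k=a+2}^{S+1}V_k^{\sigma}Y^{(k)},\qquad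 Y\overset{\mathcal L}{=}\sum_{k=1}^{c}V_k^{\sigma}X^{(k)}+\sum_{k=c+1}^{S+1}V_k^{\sigma}Y^{(k)},$$ where $V=(V_1,\dots,V_{S+1})$ is a Dirichlet distributed random vector with parameters $(\frac1S,\dots,\frac1S)$, the $X^{(k)}$ are copies of $X$ and the $Y^{(k)}$ are copies of $Y$, and all the copies occurring in an equation are independent of each other and of $V$. -/

import Mathlib

open MeasureTheory ProbabilityTheory Filter Topology
open scoped ENNReal

noncomputable section

namespace PolyaUrn

/-- One-step transition probability of the two-colour urn with replacement matrix
`(a b; c d)`, from the composition `u` (red, black) to the composition `v`: a ball is drawn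
uniformly; a red one adds `(a, b)`, a black one adds `(c, d)`. -/
def stepProb (a b c d : ℕ) (u v : ℕ × ℕ) : ℝ≥0∞ :=
  (u.1 : ℝ≥0∞) / ((u.1 : ℝ≥0∞) + (u.2 : ℝ≥0∞)) * (if v = (u.1 + a, u.2 + b) then 1 else 0)
  + (u.2 : ℝ≥0∞) / ((u.1 : ℝ≥0∞) + (u.2 : ℝ≥0∞)) * (if v = (u.1 + c, u.2 + d) then 1 else 0)

/-- `U` is a discrete time two-colour urn process with replacement matrix `(a b; c d)` and
initial composition `u₀`, i.e. the Markov chain started at `u₀` with the transition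
probabilities `stepProb a b c d` (`h` is the history of the urn up to time `n`). -/
structure IsUrnProcess {Ω : Type*} [MeasurableSpace Ω] (a b c d : ℕ) (u₀ : ℕ × ℕ)
    (U : ℕ → Ω → ℕ × ℕ) (μ : Measure Ω) : Prop where
  measurable : ∀ n, Measurable (U n)
  init : ∀ᵐ ω ∂μ, U 0 ω = u₀
  step : ∀ (n : ℕ) (h : ℕ → ℕ × ℕ) (v : ℕ × ℕ),
    μ {ω | (∀ i ≤ n, U i ω = h i) ∧ U (n + 1) ω = v}
      = μ {ω | ∀ i ≤ n, U i ω = h i} * stepProb a b c d (h n) v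

/-- The ratio `σ = m / S` of the eigenvalues `m = a - c` and `S` of the replacement matrix. -/
def ratio (a c S : ℕ) : ℝ := ((a : ℝ) - (c : ℝ)) / (S : ℝ)

/-- The eigenform `u₂(x, y) = (b x - c y) / S`. -/
def u₂ (b c S : ℕ) (u : ℕ × ℕ) : ℝ := ((b : ℝ) * (u.1 : ℝ) - (c : ℝ) * (u.2 : ℝ)) / (S : ℝ)

/-- The normalised projection `u₂(U(n)) / n ^ σ`. -/
def normalized {Ω : Type*} (a b c S : ℕ) (U : ℕ → Ω → ℕ × ℕ) (n : ℕ) (ω : Ω) : ℝ :=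
  u₂ b c S (U n ω) / (n : ℝ) ^ ratio a c S

/-- The limit variable `W = lim u₂(U(n)) / n ^ σ`. -/
def limitW {Ω : Type*} (a b c S : ℕ) (U : ℕ → Ω → ℕ × ℕ) (ω : Ω) : ℝ :=
  limUnder atTop (fun n => normalized a b c S U n ω)

/-- The point `(x₁, …, xₙ, 1 - ∑ xₖ)`. -/
def simplexPoint (n : ℕ) (x : Fin n → ℝ) : Fin (n + 1) → ℝ :=
  Fin.snoc (α := fun _ => ℝ) x (1 - ∑ i, x i)

lemma measurable_simplexPoint (n : ℕ) : Measurable (simplexPoint n) := by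
  refine measurable_pi_iff.2 fun k => ?_
  refine Fin.lastCases ?_ (fun i => ?_) k
  · simp only [simplexPoint, Fin.snoc_last]
    fun_prop
  · simp only [simplexPoint, Fin.snoc_castSucc]
    fun_prop

/-- The measure `dΣ` on the `n`-dimensional simplex in `ℝ ^ (n + 1)`: Lebesgue measure in the
first `n` coordinates. -/
def simplexMeasure (n : ℕ) : Measure (Fin (n + 1) → ℝ) :=
  ((volume : Measure (Fin n → ℝ)).restrict
    {x | (∀ i, x i ∈ Set.Icc (0 : ℝ) 1) ∧ ∑ i, x i ≤ 1}).map (simplexPoint n)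

/-- The Dirichlet distribution with parameters `ν₀, …, νₙ`. -/
def dirichletMeasure {n : ℕ} (ν : Fin (n + 1) → ℝ) : Measure (Fin (n + 1) → ℝ) :=
  (simplexMeasure n).withDensity fun x =>
    ENNReal.ofReal (Real.Gamma (∑ k, ν k) / (∏ k, Real.Gamma (ν k)) * ∏ k, x k ^ (ν k - 1))

/-- `V` is a Dirichlet vector of size `S + 1` with all parameters `1 / S`; among the variables
`Z 0, …, Z S` the first `r` are copies of `X` and the others are copies of `Y`; all the `Z k`
are independent of each other and of `V`. (The index `k : Fin (S + 1)` stands for the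
`(k + 1)`-st variable.) -/
structure IsCopyFamily {Ω Ω₁ Ω₂ : Type*} [MeasurableSpace Ω] [MeasurableSpace Ω₁]
    [MeasurableSpace Ω₂] (S r : ℕ) (X : Ω₁ → ℝ) (μ₁ : Measure Ω₁) (Y : Ω₂ → ℝ)
    (μ₂ : Measure Ω₂) (V : Ω → Fin (S + 1) → ℝ) (Z : Fin (S + 1) → Ω → ℝ)
    (P : Measure Ω) : Prop where
  law_V : HasLaw V (dirichletMeasure fun _ : Fin (S + 1) => 1 / (S : ℝ)) P
  copy_X : ∀ k : Fin (S + 1), (k : ℕ) < r → IdentDistrib (Z k) X P μ₁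
  copy_Y : ∀ k : Fin (S + 1), r ≤ (k : ℕ) → IdentDistrib (Z k) Y P μ₂
  indep_Z : iIndepFun Z P
  indep_V : IndepFun V (fun ω k => Z k ω) P

end PolyaUrn

end

/-!
Let `T f u = 𝔼 f (U 1)` be the transition operator of the urn started from `u`, so that
`𝔼 f (U n) = T ^ n f u`.

*Existence of the limits.* `u₂` is an eigenform: `T u₂ u = (1 + σ / s) u₂ u`, where `s` is the
number of balls of `u` divided by `S` and increases by one at each draw. Dividing `u₂ (U n)` by the
growth factor `(s + σ)ₙ / (s)ₙ`, which is asymptotic to a constant times `n ^ σ`, gives a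
martingale, and it is bounded in `L²` because `σ > 1 / 2` makes the sum of the `n ^ (-2 σ)` finite.

*Decomposition.* For a character `f` of `ℕ × ℕ`, the generating series
`∑ (s)ₙ / n! T ^ n f u zⁿ` is multiplicative in `u`. Comparing coefficients, `T ^ n f (∑ u k)` is a
sum of the products `∏ T ^ (l k) f (u k)` over the compositions `l` of `n`, with
Dirichlet-multinomial weights, i.e. a multinomial sum averaged over a Dirichlet vector `v`. Take
`f = exp (i t u₂ / n ^ σ)` and let `n → ∞`: by the law of large numbers `l k / n → v k`, and the
products converge to `∏ φₖ (t (v k) ^ σ)` with `φₖ` the characteristic function of the limit for the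
urn started from `u k`.

*Smoothing equations.* The first draw is deterministic and turns `(1, 0)` into `(a + 1, b)` and
`(0, 1)` into `(c, d + 1)`, which are sums of `S + 1` single balls, each of weight `1 / S`.
-/

noncomputable section

namespace PolyaUrn

/-- The transition operator of the urn: the mean of `f` after one draw from the composition `u`.
It vanishes at the empty urn, where the proportions are `0 / 0 = 0`. -/
def transfer (a b c d : ℕ) {E : Type*} [AddCommMonoid E] [Module ℝ E] (f : ℕ × ℕ → E)
    (u : ℕ × ℕ) : E :=
  ((u.1 : ℝ) / ((u.1 : ℝ) + (u.2 : ℝ))) • f (u + (a, b))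
    + ((u.2 : ℝ) / ((u.1 : ℝ) + (u.2 : ℝ))) • f (u + (c, d))

lemma norm_transfer_le {E : Type*} [NormedAddCommGroup E] [NormedSpace ℝ E] {a b c d : ℕ}
    {f : ℕ × ℕ → E} {C : ℝ} (hf : ∀ u, ‖f u‖ ≤ C) (u : ℕ × ℕ) : ‖transfer a b c d f u‖ ≤ C := by
  have hC : 0 ≤ C := (norm_nonneg _).trans (hf 0)
  have hproportions : (u.1 : ℝ) / (u.1 + u.2) + u.2 / (u.1 + u.2) ≤ 1 := by
    rw [← add_div]
    exact div_self_le_one _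
  calc ‖transfer a b c d f u‖ ≤ (u.1 : ℝ) / (u.1 + u.2) * C + u.2 / (u.1 + u.2) * C := by
        refine (norm_add_le _ _).trans (add_le_add ?_ ?_) <;>
          rw [norm_smul, Real.norm_of_nonneg (by positivity)] <;> gcongr <;> exact hf _
    _ ≤ C := by nlinarith

lemma norm_iterate_transfer_le {E : Type*} [NormedAddCommGroup E] [NormedSpace ℝ E]
    {a b c d : ℕ} {f : ℕ × ℕ → E} {C : ℝ} (hf : ∀ u, ‖f u‖ ≤ C) (n : ℕ) (u : ℕ × ℕ) :
    ‖(transfer a b c d)^[n] f u‖ ≤ C := by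
  induction n generalizing u with
  | zero => exact hf u
  | succ n ih =>
    rw [Function.iterate_succ_apply']
    exact norm_transfer_le ih u

/-- The number of balls in units of the row sum `S`, so that each draw adds `1`. -/
def weight (S : ℕ) (u : ℕ × ℕ) : ℝ := ((u.1 : ℝ) + (u.2 : ℝ)) / (S : ℝ)

lemma ascPochhammer_eval_succ_left (n : ℕ) (s : ℝ) :
    (ascPochhammer ℝ (n + 1)).eval s = s * (ascPochhammer ℝ n).eval (s + 1) := by
  simp [ascPochhammer_succ_left, Polynomial.eval_comp]

lemma coeff_prod_eq_sum_piAntidiag {R ι : Type*} [CommSemiring R] [Fintype ι]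
    [DecidableEq ι] (φ : ι → PowerSeries R) (n : ℕ) :
    PowerSeries.coeff n (∏ k, φ k)
      = ∑ l ∈ Finset.piAntidiag Finset.univ n, ∏ k, PowerSeries.coeff (l k) (φ k) := by
  rw [PowerSeries.coeff_prod]
  exact Finset.sum_nbij' (fun l k => l k) Finsupp.equivFunOnFinite.symm
    (fun l hl => by simpa using hl) (fun l hl => by simpa using hl)
    (fun l _ => by ext; simp) (fun l _ => by ext; simp) fun l _ => rfl

section weight

variable {S : ℕ}

lemma weight_zero : weight S 0 = 0 := by simp [weight]

lemma weight_add (u v : ℕ × ℕ) : weight S (u + v) = weight S u + weight S v := by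
  simp only [weight, Prod.fst_add, Prod.snd_add, Nat.cast_add]
  ring

lemma weight_sum {ι : Type*} (s : Finset ι) (u : ι → ℕ × ℕ) :
    weight S (∑ k ∈ s, u k) = ∑ k ∈ s, weight S (u k) :=
  map_sum (AddMonoidHom.mk' (weight S) weight_add) u s

lemma weight_pos (hS : S ≠ 0) {u : ℕ × ℕ} (hu : u ≠ 0) : 0 < weight S u := by
  have hballs : 0 < u.1 + u.2 := by
    by_contra! h
    exact hu (Prod.ext (by simp; omega) (by simp; omega))
  exact div_pos (by exact_mod_cast hballs) (by exact_mod_cast Nat.pos_of_ne_zero hS)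

lemma weight_add_row (hS : S ≠ 0) {p q : ℕ} (hpq : p + q = S) (u : ℕ × ℕ) :
    weight S (u + (p, q)) = weight S u + 1 := by
  have hrow : weight S (p, q) = 1 := by
    rw [weight, ← Nat.cast_add, hpq, div_self (by exact_mod_cast hS)]
  rw [weight_add, hrow]

end weight

section generatingFunction

variable {R : Type*} [CommRing R] [Algebra ℝ R] {a b c d S : ℕ}

/-- The generating function `∑ₙ (s)ₙ / n! Tⁿf(u) zⁿ`, where `T` is the transition operator and
`s` is the weight of `u`. -/
def genFun (a b c d S : ℕ) (f : ℕ × ℕ → R) (u : ℕ × ℕ) : PowerSeries R :=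
  PowerSeries.mk fun n =>
    ((ascPochhammer ℝ n).eval (weight S u) / n.factorial) • (transfer a b c d)^[n] f u

lemma coeff_genFun (f : ℕ × ℕ → R) (u : ℕ × ℕ) (n : ℕ) :
    PowerSeries.coeff n (genFun a b c d S f u)
      = ((ascPochhammer ℝ n).eval (weight S u) / n.factorial) • (transfer a b c d)^[n] f u :=
  PowerSeries.coeff_mk _ _

lemma derivative_genFun (hab : a + b = S) (hcd : c + d = S) (hS : S ≠ 0) (f : ℕ × ℕ → R)
    (u : ℕ × ℕ) :
    PowerSeries.derivative R (genFun a b c d S f u)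
      = ((u.1 : ℝ) / S) • genFun a b c d S f (u + (a, b))
        + ((u.2 : ℝ) / S) • genFun a b c d S f (u + (c, d)) := by
  have hS' : (S : ℝ) ≠ 0 := by exact_mod_cast hS
  ext n
  have hn : ((n : ℝ) + 1) ≠ 0 := by positivity
  have hsmul (x : R) : x * ((n : R) + 1) = ((n : ℝ) + 1) • x := by
    simp [Algebra.smul_def, mul_comm]
  simp only [PowerSeries.coeff_derivative, hsmul, map_add, LinearMap.map_smul_of_tower,
    coeff_genFun, weight_add_row hS hab, weight_add_row hS hcd, ascPochhammer_eval_succ_left,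
    Function.iterate_succ_apply', Nat.factorial_succ, Nat.cast_mul, Nat.cast_succ]
  rcases eq_or_ne u 0 with rfl | hu
  · simp [weight_zero]
  have hballs : (u.1 : ℝ) + u.2 ≠ 0 := (div_ne_zero_iff.1 (weight_pos hS hu).ne').1
  simp only [transfer, smul_add, smul_smul, weight]
  congr 2 <;> field_simp

lemma derivative_genFun_mul (hab : a + b = S) (hcd : c + d = S) (hS : S ≠ 0) (f : ℕ × ℕ → R)
    (u v : ℕ × ℕ) :
    PowerSeries.derivative R (genFun a b c d S f u * genFun a b c d S f v)
      = ((u.1 : ℝ) / S) • (genFun a b c d S f (u + (a, b)) * genFun a b c d S f v)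
        + ((u.2 : ℝ) / S) • (genFun a b c d S f (u + (c, d)) * genFun a b c d S f v)
        + (((v.1 : ℝ) / S) • (genFun a b c d S f u * genFun a b c d S f (v + (a, b)))
        + ((v.2 : ℝ) / S) • (genFun a b c d S f u * genFun a b c d S f (v + (c, d)))) := by
  rw [Derivation.leibniz, derivative_genFun hab hcd hS, derivative_genFun hab hcd hS]
  simp only [smul_eq_mul, mul_comm (genFun a b c d S f v), mul_add, add_mul, mul_smul_comm,
    smul_mul_assoc]
  abel

lemma genFun_add (hab : a + b = S) (hcd : c + d = S) (hS : S ≠ 0) (f : AddChar (ℕ × ℕ) R)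
    (u v : ℕ × ℕ) :
    genFun a b c d S f (u + v) = genFun a b c d S f u * genFun a b c d S f v := by
  ext n
  induction n generalizing u v with
  | zero => simp [PowerSeries.coeff_mul, coeff_genFun, f.map_add_eq_mul]
  | succ n ih =>
    have hunit : IsUnit ((n : R) + 1) := by
      simpa using (show ((n : ℝ) + 1) ≠ 0 by positivity).isUnit.map (algebraMap ℝ R)
    apply hunit.mul_right_cancel
    rw [← PowerSeries.coeff_derivative, ← PowerSeries.coeff_derivative,
      derivative_genFun hab hcd hS, derivative_genFun_mul hab hcd hS]
    simp only [map_add, LinearMap.map_smul_of_tower, ← ih, Prod.fst_add, Prod.snd_add,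
      Nat.cast_add, add_div, add_smul, add_right_comm u _ v, ← add_assoc u v]
    abel

lemma genFun_zero (f : AddChar (ℕ × ℕ) R) :
    genFun a b c d S f 0 = 1 := by
  ext n
  rw [coeff_genFun, weight_zero, ascPochhammer_eval_zero, PowerSeries.coeff_one]
  rcases eq_or_ne n 0 with rfl | hn <;> simp [*]

lemma genFun_sum (hab : a + b = S) (hcd : c + d = S) (hS : S ≠ 0) (f : AddChar (ℕ × ℕ) R)
    {ι : Type*} (s : Finset ι) (u : ι → ℕ × ℕ) :
    genFun a b c d S f (∑ k ∈ s, u k) = ∏ k ∈ s, genFun a b c d S f (u k) := by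
  classical
  induction s using Finset.induction_on with
  | empty => simp [genFun_zero]
  | insert k s hk ih =>
    rw [Finset.sum_insert hk, Finset.prod_insert hk, genFun_add hab hcd hS, ih]

/-- The probability of the occupation numbers `l` under the Dirichlet-multinomial distribution
with parameters `ν`. -/
def dirichletMultinomial {ι : Type*} [Fintype ι] (ν : ι → ℝ) (l : ι → ℕ) : ℝ :=
  Nat.multinomial Finset.univ l * ((∏ k, (ascPochhammer ℝ (l k)).eval (ν k))
    / (ascPochhammer ℝ (∑ k, l k)).eval (∑ k, ν k))

theorem iterate_transfer_sum (hab : a + b = S) (hcd : c + d = S) (hS : S ≠ 0)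
    (f : AddChar (ℕ × ℕ) R) {ι : Type*} [Fintype ι] [DecidableEq ι] {u : ι → ℕ × ℕ}
    (hu : ∑ k, u k ≠ 0) (n : ℕ) :
    (transfer a b c d)^[n] f (∑ k, u k)
      = ∑ l ∈ Finset.piAntidiag Finset.univ n, dirichletMultinomial (fun k => weight S (u k)) l
          • ∏ k, (transfer a b c d)^[l k] f (u k) := by
  have hpos := ascPochhammer_pos n _ (weight_pos hS hu)
  have : (n.factorial : ℝ) ≠ 0 := by exact_mod_cast n.factorial_ne_zero
  have hcoeff := coeff_genFun (a := a) (b := b) (c := c) (d := d) (S := S) f (∑ k, u k) n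
  rw [genFun_sum hab hcd hS, coeff_prod_eq_sum_piAntidiag, ← inv_smul_eq_iff₀ (by positivity)]
    at hcoeff
  rw [← hcoeff, Finset.smul_sum]
  refine Finset.sum_congr rfl fun l hl => ?_
  have hl : ∑ k, l k = n := (Finset.mem_piAntidiag.1 hl).1
  have hspec : (∏ k, ((l k).factorial : ℝ)) * Nat.multinomial Finset.univ l = n.factorial := by
    exact_mod_cast hl ▸ Nat.multinomial_spec Finset.univ l
  have hprod : (∏ k, ((l k).factorial : ℝ)) ≠ 0 :=
    Finset.prod_ne_zero_iff.2 fun k _ => by exact_mod_cast (l k).factorial_ne_zero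
  simp only [coeff_genFun, Finset.prod_smul, smul_smul, Finset.prod_div_distrib]
  congr 1
  rw [dirichletMultinomial, hl, ← weight_sum, ← hspec]
  field_simp

end generatingFunction

section Dirichlet

lemma lintegral_Ioo_zero_one_rpow_mul_rpow {p q : ℝ} (hp : 0 < p) (hq : 0 < q) :
    ∫⁻ x in Set.Ioo (0 : ℝ) 1, ENNReal.ofReal (x ^ (p - 1) * (1 - x) ^ (q - 1))
      = ENNReal.ofReal (beta p q) := by
  have hbeta := beta_pos hp hq
  have hpdf : ENNReal.ofReal (1 / beta p q)
      * ∫⁻ x in Set.Ioo (0 : ℝ) 1, ENNReal.ofReal (x ^ (p - 1) * (1 - x) ^ (q - 1)) = 1 := by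
    rw [← lintegral_betaPDF_eq_one hp hq, lintegral_betaPDF, ← lintegral_const_mul _ (by fun_prop)]
    simp_rw [mul_assoc, ← ENNReal.ofReal_mul (one_div_pos.2 hbeta).le]
  rw [one_div, ENNReal.ofReal_inv_of_pos hbeta] at hpdf
  rw [ENNReal.eq_inv_of_mul_eq_one_left ((mul_comm _ _).trans hpdf), inv_inv]

lemma lintegral_Ioo_eq_mul_lintegral_Ioo_zero_one {s : ℝ} (hs : 0 < s) {g : ℝ → ℝ≥0∞}
    (hg : Measurable g) :
    ∫⁻ x in Set.Ioo 0 s, g x = ENNReal.ofReal s * ∫⁻ x in Set.Ioo (0 : ℝ) 1, g (s * x) := by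
  have hpreimage : (s * ·) ⁻¹' Set.Ioo 0 s = Set.Ioo (0 : ℝ) 1 := by
    simp [Set.preimage_const_mul_Ioo₀ _ _ hs, hs.ne']
  conv_lhs => rw [← Real.smul_map_volume_mul_left hs.ne', Measure.restrict_smul,
    lintegral_smul_measure, setLIntegral_map measurableSet_Ioo hg (by fun_prop), hpreimage,
    abs_of_pos hs, smul_eq_mul]

lemma lintegral_Icc_rpow_mul_sub_rpow {p q s : ℝ} (hp : 0 < p) (hq : 0 < q) (hs : 0 < s) :
    ∫⁻ x in Set.Icc 0 s, ENNReal.ofReal (x ^ (p - 1) * (s - x) ^ (q - 1))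
      = ENNReal.ofReal (s ^ (p + q - 1) * (Real.Gamma p * Real.Gamma q / Real.Gamma (p + q))) := by
  have hscale : ∀ x ∈ Set.Ioo (0 : ℝ) 1,
      ENNReal.ofReal ((s * x) ^ (p - 1) * (s - s * x) ^ (q - 1))
        = ENNReal.ofReal (s ^ (p - 1) * s ^ (q - 1))
          * ENNReal.ofReal (x ^ (p - 1) * (1 - x) ^ (q - 1)) := by
    rintro x ⟨hx0, hx1⟩
    rw [← ENNReal.ofReal_mul (by positivity), Real.mul_rpow hs.le hx0.le,
      show s - s * x = s * (1 - x) by ring, Real.mul_rpow hs.le (by linarith),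
      mul_mul_mul_comm]
  have hpow : s * (s ^ (p - 1) * s ^ (q - 1)) = s ^ (p + q - 1) := by
    rw [← Real.rpow_add hs, mul_comm, ← Real.rpow_add_one hs.ne']
    ring_nf
  rw [← Measure.restrict_congr_set Ioo_ae_eq_Icc,
    lintegral_Ioo_eq_mul_lintegral_Ioo_zero_one hs (by fun_prop),
    setLIntegral_congr_fun measurableSet_Ioo hscale, lintegral_const_mul _ (by fun_prop),
    lintegral_Ioo_zero_one_rpow_mul_rpow hp hq, ← ENNReal.ofReal_mul (by positivity),
    ← ENNReal.ofReal_mul hs.le, ← mul_assoc, hpow, beta]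

/-- The simplex in `ℝⁿ` cut out of the positive orthant by `∑ xᵢ ≤ s`. -/
def cornerSimplex (n : ℕ) (s : ℝ) : Set (Fin n → ℝ) := {x | (∀ i, 0 ≤ x i) ∧ ∑ i, x i ≤ s}

lemma measurableSet_cornerSimplex (n : ℕ) (s : ℝ) : MeasurableSet (cornerSimplex n s) :=
  (measurableSet_Ici (a := (0 : Fin n → ℝ))).inter
    (measurableSet_le (f := fun x : Fin n → ℝ => ∑ i, x i) (by fun_prop) measurable_const)

lemma cons_mem_cornerSimplex_iff {n : ℕ} {s t : ℝ} {y : Fin n → ℝ} :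
    (Fin.cons t y : Fin (n + 1) → ℝ) ∈ cornerSimplex (n + 1) s
      ↔ t ∈ Set.Icc 0 s ∧ y ∈ cornerSimplex n (s - t) := by
  simp only [cornerSimplex, Set.mem_ofPred_eq, Fin.forall_fin_succ, Fin.sum_univ_succ,
    Fin.cons_zero, Fin.cons_succ, Set.mem_Icc]
  constructor
  · rintro ⟨⟨ht, hy⟩, hsum⟩
    have := Finset.sum_nonneg fun i (_ : i ∈ Finset.univ) => hy i
    exact ⟨⟨ht, by linarith⟩, hy, by linarith⟩
  · rintro ⟨⟨ht, -⟩, hy, hsum⟩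
    exact ⟨⟨ht, hy⟩, by linarith⟩

lemma lintegral_cornerSimplex_succ (n : ℕ) (s : ℝ) {g : (Fin (n + 1) → ℝ) → ℝ≥0∞}
    (hg : Measurable g) :
    ∫⁻ x in cornerSimplex (n + 1) s, g x
      = ∫⁻ t in Set.Icc 0 s, ∫⁻ y in cornerSimplex n (s - t), g (Fin.cons t y) := by
  let e := (MeasurableEquiv.piFinSuccAbove (fun _ : Fin (n + 1) => ℝ) 0).symm
  have he : MeasurePreserving e :=
    (volume_preserving_piFinSuccAbove (fun _ : Fin (n + 1) => ℝ) 0).symm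
  have hcons (z : ℝ × (Fin n → ℝ)) : e z = (Fin.cons z.1 z.2 : Fin (n + 1) → ℝ) := by
    simp only [e, MeasurableEquiv.piFinSuccAbove_symm_apply, Fin.insertNthEquiv_zero]
    rfl
  have hm : Measurable ((cornerSimplex (n + 1) s).indicator g) :=
    hg.indicator (measurableSet_cornerSimplex _ _)
  rw [← lintegral_indicator (measurableSet_cornerSimplex _ _),
    ← he.lintegral_comp hm, Measure.volume_eq_prod,
    lintegral_prod (fun z => (cornerSimplex (n + 1) s).indicator g (e z))
      (hm.comp e.measurable).aemeasurable, ← lintegral_indicator measurableSet_Icc]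
  refine lintegral_congr fun t => ?_
  by_cases ht : t ∈ Set.Icc 0 s
  · rw [Set.indicator_of_mem ht, ← lintegral_indicator (measurableSet_cornerSimplex _ _)]
    refine lintegral_congr fun y => ?_
    classical
    rw [hcons, Set.indicator_apply, Set.indicator_apply]
    exact if_congr (cons_mem_cornerSimplex_iff.trans (and_iff_right ht)) rfl rfl
  · simp [hcons, Set.indicator, cons_mem_cornerSimplex_iff, ht]

theorem lintegral_cornerSimplex_prod_rpow (n : ℕ) {ν : Fin n → ℝ} {q s : ℝ} (hν : ∀ i, 0 < ν i)
    (hq : 0 < q) (hs : 0 < s) :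
    ∫⁻ x in cornerSimplex n s,
        ENNReal.ofReal ((∏ i, x i ^ (ν i - 1)) * (s - ∑ i, x i) ^ (q - 1))
      = ENNReal.ofReal (s ^ (∑ i, ν i + q - 1)
          * ((∏ i, Real.Gamma (ν i)) * Real.Gamma q / Real.Gamma (∑ i, ν i + q))) := by
  induction n generalizing s with
  | zero =>
    have hset : cornerSimplex 0 s = Set.univ := by
      ext x
      simp [cornerSimplex, hs.le]
    rw [hset, Measure.restrict_univ, volume_pi, Measure.pi_of_empty, lintegral_dirac]
    simp [(Real.Gamma_pos_of_pos hq).ne']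
  | succ n ih =>
    set Q := ∑ i, ν (Fin.succ i) + q with hQ
    have hQpos : 0 < Q := add_pos_of_nonneg_of_pos (Finset.sum_nonneg fun i _ => (hν _).le) hq
    have hΓQ := Real.Gamma_pos_of_pos hQpos
    set K := (∏ i, Real.Gamma (ν (Fin.succ i))) * Real.Gamma q / Real.Gamma Q with hK
    have hKnonneg : 0 ≤ K := div_nonneg (mul_nonneg
      (Finset.prod_nonneg fun i _ => (Real.Gamma_pos_of_pos (hν _)).le)
      (Real.Gamma_pos_of_pos hq).le) hΓQ.le
    have hslice : ∀ t ∈ Set.Ico 0 s, ∫⁻ y in cornerSimplex n (s - t),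
        ENNReal.ofReal ((∏ i, (Fin.cons t y : Fin (n + 1) → ℝ) i ^ (ν i - 1))
          * (s - ∑ i, (Fin.cons t y : Fin (n + 1) → ℝ) i) ^ (q - 1))
        = ENNReal.ofReal K * ENNReal.ofReal (t ^ (ν 0 - 1) * (s - t) ^ (Q - 1)) := by
      rintro t ⟨ht0, hts⟩
      have hpow := Real.rpow_nonneg ht0 (ν 0 - 1)
      simp only [Fin.prod_univ_succ, Fin.sum_univ_succ, Fin.cons_zero, Fin.cons_succ,
        ← sub_sub, mul_assoc, ENNReal.ofReal_mul hpow]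
      rw [lintegral_const_mul _ (by fun_prop), ih (fun i => hν _) (sub_pos.2 hts),
        ← ENNReal.ofReal_mul hpow, ← ENNReal.ofReal_mul hpow, ← ENNReal.ofReal_mul hKnonneg]
      congr 1
      ring
    rw [lintegral_cornerSimplex_succ n s (by fun_prop),
      ← Measure.restrict_congr_set Ico_ae_eq_Icc, setLIntegral_congr_fun measurableSet_Ico hslice,
      Measure.restrict_congr_set Ico_ae_eq_Icc, lintegral_const_mul _ (by fun_prop),
      lintegral_Icc_rpow_mul_sub_rpow (hν 0) hQpos hs, ← ENNReal.ofReal_mul hKnonneg,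
      Fin.sum_univ_succ, Fin.prod_univ_succ, add_assoc, ← hQ, hK]
    congr 1
    field_simp

lemma prod_simplexPoint {M : Type*} [CommMonoid M] {n : ℕ} (f : Fin (n + 1) → ℝ → M)
    (x : Fin n → ℝ) :
    ∏ k, f k (simplexPoint n x k)
      = (∏ i : Fin n, f i.castSucc (x i)) * f (Fin.last n) (1 - ∑ i, x i) := by
  simp [Fin.prod_univ_castSucc, simplexPoint]

lemma forall_simplexPoint_iff {n : ℕ} {p : ℝ → Prop} {x : Fin n → ℝ} :
    (∀ k, p (simplexPoint n x k)) ↔ (∀ i, p (x i)) ∧ p (1 - ∑ i, x i) := by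
  simp [Fin.forall_fin_succ', simplexPoint]

lemma simplexMeasure_eq_map_restrict_cornerSimplex (n : ℕ) :
    simplexMeasure n
      = ((volume : Measure (Fin n → ℝ)).restrict (cornerSimplex n 1)).map (simplexPoint n) := by
  have hset : {x : Fin n → ℝ | (∀ i, x i ∈ Set.Icc (0 : ℝ) 1) ∧ ∑ i, x i ≤ 1}
      = cornerSimplex n 1 := by
    ext x
    refine ⟨fun h => ⟨fun i => (h.1 i).1, h.2⟩, fun h => ⟨fun i => ⟨h.1 i, ?_⟩, h.2⟩⟩
    exact (Finset.single_le_sum (fun j _ => h.1 j) (Finset.mem_univ i)).trans h.2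
  rw [simplexMeasure, hset]

theorem lintegral_simplexMeasure_prod_rpow {n : ℕ} {ν : Fin (n + 1) → ℝ} (hν : ∀ k, 0 < ν k) :
    ∫⁻ x, ENNReal.ofReal (∏ k, x k ^ (ν k - 1)) ∂simplexMeasure n
      = ENNReal.ofReal ((∏ k, Real.Gamma (ν k)) / Real.Gamma (∑ k, ν k)) := by
  rw [simplexMeasure_eq_map_restrict_cornerSimplex,
    lintegral_map (by fun_prop) (measurable_simplexPoint n)]
  simp only [prod_simplexPoint fun k y => y ^ (ν k - 1)]
  rw [lintegral_cornerSimplex_prod_rpow n (fun i => hν _) (hν _) one_pos,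
    ← Fin.prod_univ_castSucc fun k => Real.Gamma (ν k), ← Fin.sum_univ_castSucc, Real.one_rpow,
    one_mul]

lemma ae_sum_simplexMeasure (n : ℕ) : ∀ᵐ x ∂simplexMeasure n, ∑ k, x k = 1 := by
  refine (ae_map_iff (measurable_simplexPoint n).aemeasurable
    (measurableSet_eq_fun (by fun_prop) measurable_const)).2 (.of_forall fun x => ?_)
  simp [Fin.sum_univ_castSucc, simplexPoint]

lemma ae_sum_ne_one (n : ℕ) : ∀ᵐ x : Fin n → ℝ, ∑ i, x i ≠ 1 := by
  rcases n with _ | n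
  · simp
  · let L : (Fin (n + 1) → ℝ) →ₗ[ℝ] ℝ := ∑ i, LinearMap.proj i
    have hL : Function.Surjective L := fun y => ⟨Pi.single 0 y, by simp [L]⟩
    have hae : ∀ᵐ y : ℝ, y ∈ ({1}ᶜ : Set ℝ) := by simp [ae_iff]
    simpa [L] using (ae_comp_linearMap_mem_iff L volume volume hL
      (measurableSet_singleton 1).compl).2 hae

lemma ae_pos_simplexMeasure (n : ℕ) : ∀ᵐ x ∂simplexMeasure n, ∀ k, 0 < x k := by
  rw [simplexMeasure_eq_map_restrict_cornerSimplex]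
  have hm : MeasurableSet {x : Fin (n + 1) → ℝ | ∀ k, 0 < x k} := by
    rw [Set.ofPred_forall]
    exact .iInter fun k => measurableSet_lt measurable_const (measurable_pi_apply k)
  refine (ae_map_iff (measurable_simplexPoint n).aemeasurable hm).2 ?_
  have hcoord : ∀ᵐ x : Fin n → ℝ, ∀ i, x i ≠ 0 :=
    ae_all_iff.2 fun i => Measure.ae_eval_ne _ i 0
  filter_upwards [ae_restrict_of_ae hcoord, ae_restrict_of_ae (ae_sum_ne_one n),
    ae_restrict_mem (measurableSet_cornerSimplex n 1)] with x hx0 hx1 hx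
  exact forall_simplexPoint_iff.2
    ⟨fun i => (hx.1 i).lt_of_ne' (hx0 i), sub_pos.2 (hx.2.lt_of_ne hx1)⟩

lemma ae_pos_dirichletMeasure {n : ℕ} (ν : Fin (n + 1) → ℝ) :
    ∀ᵐ v ∂dirichletMeasure ν, ∀ k, 0 < v k :=
  (withDensity_absolutelyContinuous _ _).ae_le (ae_pos_simplexMeasure n)

lemma ae_sum_dirichletMeasure {n : ℕ} (ν : Fin (n + 1) → ℝ) :
    ∀ᵐ v ∂dirichletMeasure ν, ∑ k, v k = 1 :=
  (withDensity_absolutelyContinuous _ _).ae_le (ae_sum_simplexMeasure n)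

lemma Gamma_add_natCast {x : ℝ} (hx : 0 < x) (n : ℕ) :
    Real.Gamma (x + n) = (ascPochhammer ℝ n).eval x * Real.Gamma x := by
  induction n with
  | zero => simp
  | succ n ih =>
    rw [Nat.cast_succ, ← add_assoc, Real.Gamma_add_one (by positivity), ih,
      ascPochhammer_succ_eval]
    ring

theorem lintegral_dirichletMeasure_prod_pow {n : ℕ} {ν : Fin (n + 1) → ℝ} (hν : ∀ k, 0 < ν k)
    (l : Fin (n + 1) → ℕ) :
    ∫⁻ v, ENNReal.ofReal (∏ k, v k ^ l k) ∂dirichletMeasure ν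
      = ENNReal.ofReal ((∏ k, (ascPochhammer ℝ (l k)).eval (ν k))
          / (ascPochhammer ℝ (∑ k, l k)).eval (∑ k, ν k)) := by
  have hsum : 0 < ∑ k, ν k := Finset.sum_pos (fun k _ => hν k) Finset.univ_nonempty
  have hΓprod : 0 < ∏ k, Real.Gamma (ν k) :=
    Finset.prod_pos fun k _ => Real.Gamma_pos_of_pos (hν k)
  have hconst : 0 ≤ Real.Gamma (∑ k, ν k) / ∏ k, Real.Gamma (ν k) :=
    div_nonneg (Real.Gamma_pos_of_pos hsum).le hΓprod.le
  have hdensity : ∀ᵐ v ∂simplexMeasure n,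
      ENNReal.ofReal (Real.Gamma (∑ k, ν k) / (∏ k, Real.Gamma (ν k)) * ∏ k, v k ^ (ν k - 1))
          * ENNReal.ofReal (∏ k, v k ^ l k)
        = ENNReal.ofReal (Real.Gamma (∑ k, ν k) / ∏ k, Real.Gamma (ν k))
          * ENNReal.ofReal (∏ k, v k ^ (ν k + l k - 1)) := by
    filter_upwards [ae_pos_simplexMeasure n] with v hv
    rw [ENNReal.ofReal_mul hconst, mul_assoc,
      ← ENNReal.ofReal_mul (Finset.prod_nonneg fun k _ => Real.rpow_nonneg (hv k).le _),
      ← Finset.prod_mul_distrib]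
    simp only [← Real.rpow_natCast, ← Real.rpow_add (hv _), sub_add_eq_add_sub]
  rw [dirichletMeasure, lintegral_withDensity_eq_lintegral_mul _ (by fun_prop) (by fun_prop)]
  simp only [Pi.mul_apply]
  rw [lintegral_congr_ae hdensity, lintegral_const_mul _ (by fun_prop),
    lintegral_simplexMeasure_prod_rpow fun k => by have := hν k; positivity,
    ← ENNReal.ofReal_mul hconst, Finset.sum_add_distrib, ← Nat.cast_sum, Gamma_add_natCast hsum]
  simp only [Gamma_add_natCast (hν _), Finset.prod_mul_distrib]
  have := Real.Gamma_pos_of_pos hsum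
  congr 1
  field_simp

lemma isProbabilityMeasure_dirichletMeasure {n : ℕ} {ν : Fin (n + 1) → ℝ} (hν : ∀ k, 0 < ν k) :
    IsProbabilityMeasure (dirichletMeasure ν) :=
  ⟨by simpa using lintegral_dirichletMeasure_prod_pow hν 0⟩

theorem integral_dirichletMeasure_prod_pow {n : ℕ} {ν : Fin (n + 1) → ℝ} (hν : ∀ k, 0 < ν k)
    (l : Fin (n + 1) → ℕ) :
    ∫ v, ∏ k, v k ^ l k ∂dirichletMeasure ν
      = (∏ k, (ascPochhammer ℝ (l k)).eval (ν k))
          / (ascPochhammer ℝ (∑ k, l k)).eval (∑ k, ν k) := by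
  have hsum : 0 < ∑ k, ν k := Finset.sum_pos (fun k _ => hν k) Finset.univ_nonempty
  have hnonneg : 0 ≤ᵐ[dirichletMeasure ν] fun v => ∏ k, v k ^ l k := by
    filter_upwards [ae_pos_dirichletMeasure ν] with v hv
    exact Finset.prod_nonneg fun k _ => pow_nonneg (hv k).le _
  rw [integral_eq_lintegral_of_nonneg_ae hnonneg
      (Measurable.aestronglyMeasurable (by fun_prop)),
    lintegral_dirichletMeasure_prod_pow hν, ENNReal.toReal_ofReal]
  exact div_nonneg (Finset.prod_nonneg fun k _ => (ascPochhammer_pos _ _ (hν k)).le)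
    (ascPochhammer_pos _ _ hsum).le

end Dirichlet

section multinomial

variable {ι : Type*} [Fintype ι]

/-- The probability of the occupation numbers `l` under the multinomial distribution with cell
probabilities `v`. -/
def multinomialWeight (v : ι → ℝ) (l : ι → ℕ) : ℝ :=
  Nat.multinomial Finset.univ l * ∏ k, v k ^ l k

lemma multinomialWeight_nonneg {v : ι → ℝ} (hv : ∀ k, 0 ≤ v k) (l : ι → ℕ) :
    0 ≤ multinomialWeight v l :=
  mul_nonneg (Nat.cast_nonneg _) (Finset.prod_nonneg fun k _ => pow_nonneg (hv k) _)

lemma integral_multinomialWeight_dirichletMeasure {n : ℕ} {ν : Fin (n + 1) → ℝ}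
    (hν : ∀ k, 0 < ν k) (l : Fin (n + 1) → ℕ) :
    ∫ v, multinomialWeight v l ∂dirichletMeasure ν = dirichletMultinomial ν l := by
  simp only [multinomialWeight, dirichletMultinomial]
  rw [integral_const_mul, integral_dirichletMeasure_prod_pow hν]

variable [DecidableEq ι] {v : ι → ℝ}

lemma sum_multinomialWeight (hsum : ∑ k, v k = 1) (n : ℕ) :
    ∑ l ∈ Finset.piAntidiag Finset.univ n, multinomialWeight v l = 1 := by
  simp only [multinomialWeight, ← Finset.sum_pow_eq_sum_piAntidiag, hsum, one_pow]

open Polynomial in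
lemma sum_multinomialWeight_mul_X_pow (hsum : ∑ k, v k = 1) (n : ℕ) (k : ι) :
    ∑ l ∈ Finset.piAntidiag Finset.univ n, C (multinomialWeight v l) * X ^ l k
      = (1 + C (v k) * (X - 1)) ^ n := by
  have hbase : ∑ j, C (v j) * (if j = k then X else 1) = 1 + C (v k) * (X - 1) := by
    have hsplit (j : ι) : C (v j) * (if j = k then X else 1)
        = C (v j) + if j = k then C (v j) * (X - 1) else 0 := by
      split_ifs <;> ring
    simp only [hsplit, Finset.sum_add_distrib, ← map_sum, hsum, map_one, Finset.sum_ite_eq',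
      Finset.mem_univ, if_true]
  rw [← hbase, Finset.sum_pow_eq_sum_piAntidiag]
  refine Finset.sum_congr rfl fun l _ => ?_
  simp only [multinomialWeight, mul_pow, Finset.prod_mul_distrib, ite_pow, one_pow,
    Finset.prod_ite_eq', Finset.mem_univ, if_true, map_mul, map_prod, map_pow, map_natCast,
    mul_assoc]

lemma sum_multinomialWeight_mul_apply (hsum : ∑ k, v k = 1) (n : ℕ) (k : ι) :
    ∑ l ∈ Finset.piAntidiag Finset.univ n, multinomialWeight v l * l k = n * v k := by
  have h := congrArg (fun p => (Polynomial.derivative p).eval 1)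
    (sum_multinomialWeight_mul_X_pow hsum n k)
  simpa [Polynomial.eval_finsetSum, Polynomial.derivative_pow] using h

lemma sum_multinomialWeight_mul_apply_mul_sub_one (hsum : ∑ k, v k = 1) (n : ℕ) (k : ι) :
    ∑ l ∈ Finset.piAntidiag Finset.univ n, multinomialWeight v l * (l k * (l k - 1))
      = n * (n - 1) * v k ^ 2 := by
  have hcast (m : ℕ) : (m : ℝ) * ((m - 1 : ℕ) : ℝ) = m * (m - 1) := by
    cases m <;> simp
  have h := congrArg (fun p => (Polynomial.derivative (Polynomial.derivative p)).eval 1)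
    (sum_multinomialWeight_mul_X_pow hsum n k)
  rw [← hcast n]
  simpa [Polynomial.eval_finsetSum, Polynomial.derivative_pow, ← hcast, pow_two, mul_assoc]
    using h

lemma sum_multinomialWeight_mul_sub_sq (hsum : ∑ k, v k = 1) (n : ℕ) (k : ι) :
    ∑ l ∈ Finset.piAntidiag Finset.univ n, multinomialWeight v l * ((l k : ℝ) - n * v k) ^ 2
      = n * v k * (1 - v k) := by
  have hexpand (l : ι → ℕ) : multinomialWeight v l * ((l k : ℝ) - n * v k) ^ 2
      = multinomialWeight v l * (l k * (l k - 1))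
        + (1 - 2 * n * v k) * (multinomialWeight v l * l k)
        + (n * v k) ^ 2 * multinomialWeight v l := by ring
  simp only [hexpand, Finset.sum_add_distrib, ← Finset.mul_sum, sum_multinomialWeight hsum,
    sum_multinomialWeight_mul_apply hsum, sum_multinomialWeight_mul_apply_mul_sub_one hsum]
  ring

variable {E : Type*} [NormedAddCommGroup E] [NormedSpace ℝ E]

lemma norm_sum_multinomialWeight_smul_le (hv : ∀ k, 0 ≤ v k) (hsum : ∑ k, v k = 1) {n : ℕ}
    {h : (ι → ℕ) → E} {A B : ℝ} (hB : 0 ≤ B)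
    (hh : ∀ l, ‖h l‖ ≤ A + B * ∑ k, ((l k : ℝ) - n * v k) ^ 2) :
    ‖∑ l ∈ Finset.piAntidiag Finset.univ n, multinomialWeight v l • h l‖ ≤ A + B * n := by
  have hvar : ∑ k, n * v k * (1 - v k) ≤ n := by
    calc ∑ k, n * v k * (1 - v k) ≤ ∑ k, n * v k := Finset.sum_le_sum fun k _ =>
          mul_le_of_le_one_right (mul_nonneg n.cast_nonneg (hv k)) (sub_le_self _ (hv k))
      _ = n := by rw [← Finset.mul_sum, hsum, mul_one]
  calc ‖∑ l ∈ Finset.piAntidiag Finset.univ n, multinomialWeight v l • h l‖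
      ≤ ∑ l ∈ Finset.piAntidiag Finset.univ n,
          multinomialWeight v l * (A + B * ∑ k, ((l k : ℝ) - n * v k) ^ 2) := by
        refine norm_sum_le_of_le _ fun l _ => ?_
        rw [norm_smul, Real.norm_of_nonneg (multinomialWeight_nonneg hv l)]
        exact mul_le_mul_of_nonneg_left (hh l) (multinomialWeight_nonneg hv l)
    _ = A + B * ∑ k, n * v k * (1 - v k) := by
        simp only [mul_add, Finset.sum_add_distrib, ← Finset.sum_mul, sum_multinomialWeight hsum,
          mul_left_comm _ B, ← Finset.mul_sum, ← sum_multinomialWeight_mul_sub_sq hsum]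
        rw [Finset.sum_comm, one_mul]
        simp only [Finset.mul_sum]
    _ ≤ A + B * n := by gcongr

end multinomial

section lawOfLargeNumbers

variable {ι : Type*} {v : ι → ℝ}

/-- The filter of pairs `(n, l)` with `n → ∞` and `l / n → v`. -/
def proportionFilter (v : ι → ℝ) : Filter (ℕ × (ι → ℕ)) :=
  comap Prod.fst atTop ⊓ comap (fun p k => (p.2 k : ℝ) / p.1) (𝓝 v)

lemma tendsto_fst_proportionFilter : Tendsto Prod.fst (proportionFilter v) atTop :=
  tendsto_comap.mono_left inf_le_left

lemma tendsto_proportion (k : ι) :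
    Tendsto (fun p : ℕ × (ι → ℕ) => (p.2 k : ℝ) / p.1) (proportionFilter v) (𝓝 (v k)) :=
  ((continuous_apply k).tendsto v).comp (tendsto_comap.mono_left inf_le_right)

lemma tendsto_apply_proportionFilter {k : ι} (hk : 0 < v k) :
    Tendsto (fun p : ℕ × (ι → ℕ) => p.2 k) (proportionFilter v) atTop := by
  refine tendsto_natCast_atTop_iff.1 (((tendsto_proportion k).pos_mul_atTop hk
    (tendsto_natCast_atTop_atTop.comp tendsto_fst_proportionFilter)).congr' ?_)
  filter_upwards [tendsto_fst_proportionFilter.eventually_gt_atTop 0] with p hp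
  exact div_mul_cancel₀ _ (by exact_mod_cast hp.ne')

variable [Fintype ι]

lemma le_sum_sub_sq_of_le_dist {n : ℕ} (hn : 0 < n) {δ : ℝ} (hδ : 0 < δ) {l : ι → ℕ}
    (hl : δ ≤ dist (fun k => (l k : ℝ) / n) v) :
    (δ * n) ^ 2 ≤ ∑ k, ((l k : ℝ) - n * v k) ^ 2 := by
  have hn' : (0 : ℝ) < n := by exact_mod_cast hn
  obtain ⟨k, hk⟩ : ∃ k, δ ≤ |(l k : ℝ) / n - v k| := by
    by_contra! h
    exact hl.not_gt ((dist_pi_lt_iff hδ).2 h)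
  have hdev : δ * n ≤ |(l k : ℝ) - n * v k| := by
    calc δ * n ≤ |(l k : ℝ) / n - v k| * n := by gcongr
      _ = |(l k : ℝ) - n * v k| := by
        rw [← abs_of_pos hn', ← abs_mul, abs_of_pos hn', sub_mul, div_mul_cancel₀ _ hn'.ne',
          mul_comm (v k)]
  calc (δ * n) ^ 2 ≤ |(l k : ℝ) - n * v k| ^ 2 := by gcongr
    _ = ((l k : ℝ) - n * v k) ^ 2 := sq_abs _
    _ ≤ ∑ k, ((l k : ℝ) - n * v k) ^ 2 :=
      Finset.single_le_sum (f := fun k => ((l k : ℝ) - n * v k) ^ 2)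
        (fun k _ => sq_nonneg _) (Finset.mem_univ k)

variable {E : Type*} [NormedAddCommGroup E] {g : ℕ → (ι → ℕ) → E} {C : ℝ} {z : E}

/-- Chebyshev's inequality: away from `l / n = v`, the function `g n l` is only known to be
bounded, but there the squared deviations are large. -/
lemma eventually_norm_sub_le_of_tendsto_proportionFilter (hg : ∀ n l, ‖g n l‖ ≤ C)
    (hz : Tendsto (fun p : ℕ × (ι → ℕ) => g p.1 p.2) (proportionFilter v) (𝓝 z)) {ε : ℝ}
    (hε : 0 < ε) :
    ∃ δ > 0, ∀ᶠ n : ℕ in atTop, ∀ l,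
      ‖g n l - z‖ ≤ ε + (C + ‖z‖) / (δ * n) ^ 2 * ∑ k, ((l k : ℝ) - n * v k) ^ 2 := by
  have hbasis : (proportionFilter v).HasBasis (fun q : ℕ × ℝ => True ∧ 0 < q.2) fun q =>
      Prod.fst ⁻¹' Set.Ici q.1 ∩ (fun p k => (p.2 k : ℝ) / p.1) ⁻¹' Metric.ball v q.2 :=
    (atTop_basis.comap _).inf (Metric.nhds_basis_ball.comap _)
  obtain ⟨⟨N, δ⟩, ⟨-, hδ⟩, hclose⟩ :=
    hbasis.eventually_iff.1 (Metric.tendsto_nhds.1 hz ε hε)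
  have hC : 0 ≤ C + ‖z‖ := add_nonneg ((norm_nonneg _).trans (hg 0 0)) (norm_nonneg z)
  refine ⟨δ, hδ, ?_⟩
  filter_upwards [eventually_ge_atTop N, eventually_gt_atTop 0] with n hnN hn l
  rcases lt_or_ge (dist (fun k => (l k : ℝ) / n) v) δ with hl | hl
  · rw [← dist_eq_norm]
    exact (hclose (x := (n, l)) ⟨hnN, hl⟩).le.trans (le_add_of_nonneg_right (by positivity))
  · have : (0 : ℝ) < n := by exact_mod_cast hn
    calc ‖g n l - z‖ ≤ C + ‖z‖ := (norm_sub_le _ _).trans (by gcongr; exact hg n l)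
      _ = (C + ‖z‖) / (δ * n) ^ 2 * (δ * n) ^ 2 := by field_simp
      _ ≤ (C + ‖z‖) / (δ * n) ^ 2 * ∑ k, ((l k : ℝ) - n * v k) ^ 2 := by
        gcongr
        exact le_sum_sub_sq_of_le_dist hn hδ hl
      _ ≤ _ := le_add_of_nonneg_left hε.le

theorem tendsto_sum_multinomialWeight_smul [DecidableEq ι] [NormedSpace ℝ E] (hv : ∀ k, 0 ≤ v k)
    (hsum : ∑ k, v k = 1) (hg : ∀ n l, ‖g n l‖ ≤ C)
    (hz : Tendsto (fun p : ℕ × (ι → ℕ) => g p.1 p.2) (proportionFilter v) (𝓝 z)) :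
    Tendsto (fun n => ∑ l ∈ Finset.piAntidiag Finset.univ n, multinomialWeight v l • g n l) atTop
      (𝓝 z) := by
  have hC : 0 ≤ C + ‖z‖ := add_nonneg ((norm_nonneg _).trans (hg 0 0)) (norm_nonneg z)
  refine Metric.tendsto_nhds.2 fun ε hε => ?_
  obtain ⟨δ, hδ, hbound⟩ :=
    eventually_norm_sub_le_of_tendsto_proportionFilter hg hz (half_pos hε)
  have hsmall : Tendsto (fun n : ℕ => (C + ‖z‖) / δ ^ 2 / n) atTop (𝓝 0) :=
    tendsto_const_div_atTop_nhds_zero_nat _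
  filter_upwards [hbound, hsmall.eventually_lt_const (half_pos hε), eventually_gt_atTop 0]
    with n hbound hsmall hn
  have hn' : (n : ℝ) ≠ 0 := by exact_mod_cast hn.ne'
  have hcenter : ∑ l ∈ Finset.piAntidiag Finset.univ n, multinomialWeight v l • g n l - z
      = ∑ l ∈ Finset.piAntidiag Finset.univ n, multinomialWeight v l • (g n l - z) := by
    simp only [smul_sub, Finset.sum_sub_distrib, ← Finset.sum_smul, sum_multinomialWeight hsum,
      one_smul]
  rw [dist_eq_norm, hcenter]
  calc _ ≤ ε / 2 + (C + ‖z‖) / (δ * n) ^ 2 * n :=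
        norm_sum_multinomialWeight_smul_le hv hsum (by positivity) hbound
    _ = ε / 2 + (C + ‖z‖) / δ ^ 2 / n := by field_simp
    _ < ε := by linarith

end lawOfLargeNumbers

section dirichletMixture

lemma integrable_multinomialWeight_dirichletMeasure {m : ℕ} {ν : Fin (m + 1) → ℝ}
    (hν : ∀ k, 0 < ν k) (l : Fin (m + 1) → ℕ) :
    Integrable (fun v => multinomialWeight v l) (dirichletMeasure ν) := by
  have := isProbabilityMeasure_dirichletMeasure hν
  refine Integrable.const_mul (Integrable.of_bound
    (Measurable.aestronglyMeasurable (by fun_prop)) 1 ?_) _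
  filter_upwards [ae_pos_dirichletMeasure ν, ae_sum_dirichletMeasure ν] with v hpos hsum
  have hle (k : Fin (m + 1)) : v k ≤ 1 :=
    (Finset.single_le_sum (fun j _ => (hpos j).le) (Finset.mem_univ k)).trans hsum.le
  rw [Real.norm_of_nonneg (Finset.prod_nonneg fun k _ => pow_nonneg (hpos k).le _)]
  exact Finset.prod_le_one (fun k _ => pow_nonneg (hpos k).le _) fun k _ =>
    pow_le_one₀ (hpos k).le (hle k)

theorem iterate_transfer_sum_eq_integral_dirichletMeasure {R : Type*} [NormedCommRing R]
    [NormedAlgebra ℝ R] [CompleteSpace R] {a b c d S : ℕ} (hab : a + b = S) (hcd : c + d = S)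
    (hS : S ≠ 0) (f : AddChar (ℕ × ℕ) R) {m : ℕ} {u : Fin (m + 1) → ℕ × ℕ} (hu : ∀ k, u k ≠ 0)
    (n : ℕ) :
    (transfer a b c d)^[n] f (∑ k, u k)
      = ∫ v, ∑ l ∈ Finset.piAntidiag Finset.univ n,
          multinomialWeight v l • ∏ k, (transfer a b c d)^[l k] f (u k)
          ∂dirichletMeasure fun k => weight S (u k) := by
  have hν (k : Fin (m + 1)) : 0 < weight S (u k) := weight_pos hS (hu k)
  have hsum : ∑ k, u k ≠ 0 := fun h =>
    hu 0 (Finset.sum_eq_zero_iff.1 h 0 (Finset.mem_univ 0))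
  rw [iterate_transfer_sum hab hcd hS f hsum, integral_finsetSum _ fun l _ =>
    (integrable_multinomialWeight_dirichletMeasure hν l).smul_const _]
  simp only [integral_smul_const, integral_multinomialWeight_dirichletMeasure hν]

end dirichletMixture

section stepKernel

variable {a b c d : ℕ}

/-- The transition kernel of the urn. -/
def stepKernel (a b c d : ℕ) : Kernel (ℕ × ℕ) (ℕ × ℕ) where
  toFun u :=
    ((u.1 : ℝ≥0∞) / ((u.1 : ℝ≥0∞) + (u.2 : ℝ≥0∞))) • Measure.dirac (u + (a, b))
    + ((u.2 : ℝ≥0∞) / ((u.1 : ℝ≥0∞) + (u.2 : ℝ≥0∞))) • Measure.dirac (u + (c, d))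
  measurable' := measurable_of_countable _

lemma stepKernel_apply (u : ℕ × ℕ) : stepKernel a b c d u =
    ((u.1 : ℝ≥0∞) / ((u.1 : ℝ≥0∞) + (u.2 : ℝ≥0∞))) • Measure.dirac (u + (a, b))
    + ((u.2 : ℝ≥0∞) / ((u.1 : ℝ≥0∞) + (u.2 : ℝ≥0∞))) • Measure.dirac (u + (c, d)) := rfl

lemma natCast_div_add_le_one (x y : ℕ) :
    (x : ℝ≥0∞) / (x + y) ≤ 1 ∧ (y : ℝ≥0∞) / (x + y) ≤ 1 :=
  ⟨ENNReal.div_le_of_le_mul (by simp), ENNReal.div_le_of_le_mul (by simp)⟩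

instance : IsFiniteKernel (stepKernel a b c d) := by
  refine ⟨1 + 1, by simp, fun u => ?_⟩
  obtain ⟨hred, hblack⟩ := natCast_div_add_le_one u.1 u.2
  simpa [stepKernel_apply] using add_le_add hred hblack

lemma stepKernel_singleton (u v : ℕ × ℕ) :
    stepKernel a b c d u {v} = stepProb a b c d u v := by
  simp [stepKernel_apply, stepProb, Set.indicator_apply, eq_comm, Prod.ext_iff]

lemma ae_stepKernel (u : ℕ × ℕ) :
    ∀ᵐ v ∂stepKernel a b c d u, v = u + (a, b) ∨ v = u + (c, d) := by
  rw [stepKernel_apply, ae_add_measure_iff]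
  constructor <;> refine Measure.ae_smul_measure ?_ _ <;> simp [ae_dirac_eq]

lemma integral_stepKernel {E : Type*} [NormedAddCommGroup E] [NormedSpace ℝ E] [CompleteSpace E]
    (f : ℕ × ℕ → E) (u : ℕ × ℕ) :
    ∫ v, f v ∂stepKernel a b c d u = transfer a b c d f u := by
  obtain ⟨hred, hblack⟩ := natCast_div_add_le_one u.1 u.2
  have hdirac (v : ℕ × ℕ) : Integrable f (Measure.dirac v) := integrable_dirac (by simp)
  rw [stepKernel_apply,
    integral_add_measure ((hdirac _).smul_measure (hred.trans_lt ENNReal.one_lt_top).ne)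
      ((hdirac _).smul_measure (hblack.trans_lt ENNReal.one_lt_top).ne)]
  simp [transfer, integral_smul_measure, ENNReal.toReal_div, ENNReal.toReal_add]

end stepKernel

section history

variable {Ω : Type*} {U : ℕ → Ω → ℕ × ℕ}

/-- The history of the process up to time `n`, indexed so as to generate `Filtration.natural`. -/
def history (U : ℕ → Ω → ℕ × ℕ) (n : ℕ) (ω : Ω) : Set.Iic n → ℕ × ℕ := fun i => U i ω

lemma history_eq_iff {n : ℕ} {ω : Ω} {h : Set.Iic n → ℕ × ℕ} :
    history U n ω = h ↔ ∀ i ≤ n, U i ω = h ⟨min i n, min_le_right i n⟩ := by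
  refine funext_iff.trans ⟨fun H i hi => ?_, fun H i => ?_⟩
  · simpa [history, min_eq_left hi] using H ⟨i, hi⟩
  · simpa [history, min_eq_left (Set.mem_Iic.1 i.2)] using H i (Set.mem_Iic.1 i.2)

lemma measurable_history [MeasurableSpace Ω] (hU : ∀ n, Measurable (U n)) (n : ℕ) :
    Measurable (history U n) :=
  measurable_pi_lambda _ fun i => hU i

end history

namespace IsUrnProcess

variable {Ω : Type*} [MeasurableSpace Ω] {μ : Measure Ω} [IsFiniteMeasure μ] {a b c d : ℕ}
  {u₀ : ℕ × ℕ} {U : ℕ → Ω → ℕ × ℕ}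

lemma map_history_prod (hU : IsUrnProcess a b c d u₀ U μ) (n : ℕ) :
    μ.map (fun ω => (history U n ω, U (n + 1) ω)) = (μ.map (history U n)) ⊗ₘ
      ((stepKernel a b c d).comap (fun h : Set.Iic n → ℕ × ℕ => h ⟨n, Set.self_mem_Iic⟩)
        (measurable_of_countable _)) := by
  have hH := measurable_history hU.measurable n
  refine Measure.ext_of_singleton fun ⟨h, v⟩ => ?_
  rw [← Set.singleton_prod_singleton, Measure.compProd_apply_prod (measurableSet_singleton _)
    (measurableSet_singleton _), Measure.map_apply (hH.prodMk (hU.measurable _))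
    ((measurableSet_singleton _).prod (measurableSet_singleton _)), lintegral_singleton,
    Measure.map_apply hH (measurableSet_singleton _), Kernel.comap_apply, stepKernel_singleton,
    mul_comm]
  have hstep := hU.step n (fun i => h ⟨min i n, min_le_right i n⟩) v
  simp only [← history_eq_iff, min_self] at hstep
  exact hstep

lemma ae_succ_eq (hU : IsUrnProcess a b c d u₀ U μ) (n : ℕ) :
    ∀ᵐ ω ∂μ, U (n + 1) ω = U n ω + (a, b) ∨ U (n + 1) ω = U n ω + (c, d) := by
  have hae := Measure.ae_compProd_of_ae_ae (μ := μ.map (history U n))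
    (κ := (stepKernel a b c d).comap (fun h : Set.Iic n → ℕ × ℕ => h ⟨n, Set.self_mem_Iic⟩)
      (measurable_of_countable _))
    (p := fun p => p.2 = p.1 ⟨n, Set.self_mem_Iic⟩ + (a, b)
      ∨ p.2 = p.1 ⟨n, Set.self_mem_Iic⟩ + (c, d))
    (Set.to_countable _).measurableSet (ae_of_all _ fun h => ae_stepKernel _)
  rw [← hU.map_history_prod] at hae
  exact ae_of_ae_map
    ((measurable_history hU.measurable n).prodMk (hU.measurable _)).aemeasurable hae

section integral

variable {E : Type*} [NormedAddCommGroup E] [NormedSpace ℝ E] [CompleteSpace E]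

theorem setIntegral_succ (hU : IsUrnProcess a b c d u₀ U μ) (f : ℕ × ℕ → E) (n : ℕ)
    (hf : Integrable (fun ω => f (U (n + 1) ω)) μ) (A : Set (Set.Iic n → ℕ × ℕ)) :
    ∫ ω in history U n ⁻¹' A, f (U (n + 1) ω) ∂μ
      = ∫ ω in history U n ⁻¹' A, transfer a b c d f (U n ω) ∂μ := by
  have hH := measurable_history hU.measurable n
  have hpair : Measurable fun ω => (history U n ω, U (n + 1) ω) := hH.prodMk (hU.measurable _)
  have hA : MeasurableSet A := A.to_countable.measurableSet
  have hf' : AEStronglyMeasurable (fun p : (Set.Iic n → ℕ × ℕ) × (ℕ × ℕ) => f p.2)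
      (μ.map fun ω => (history U n ω, U (n + 1) ω)) :=
    StronglyMeasurable.of_discrete.aestronglyMeasurable
  have hint := (integrable_map_measure hf' hpair.aemeasurable).2 hf
  have hpre : history U n ⁻¹' A = (fun ω => (history U n ω, U (n + 1) ω)) ⁻¹' (A ×ˢ Set.univ) := by
    ext ω
    simp
  calc ∫ ω in history U n ⁻¹' A, f (U (n + 1) ω) ∂μ
      = ∫ p in A ×ˢ Set.univ, f p.2 ∂μ.map fun ω => (history U n ω, U (n + 1) ω) := by
        rw [setIntegral_map (hA.prod MeasurableSet.univ) hf' hpair.aemeasurable, hpre]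
    _ = ∫ h in A, transfer a b c d f (h ⟨n, Set.self_mem_Iic⟩) ∂μ.map (history U n) := by
        rw [hU.map_history_prod] at hint ⊢
        rw [Measure.setIntegral_compProd hA MeasurableSet.univ hint.integrableOn]
        simp only [Measure.restrict_univ, Kernel.comap_apply, integral_stepKernel]
    _ = ∫ ω in history U n ⁻¹' A, transfer a b c d f (U n ω) ∂μ := by
        rw [setIntegral_map hA StronglyMeasurable.of_discrete.aestronglyMeasurable hH.aemeasurable]
        simp only [history]

lemma integral_succ (hU : IsUrnProcess a b c d u₀ U μ) (f : ℕ × ℕ → E) (n : ℕ)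
    (hf : Integrable (fun ω => f (U (n + 1) ω)) μ) :
    ∫ ω, f (U (n + 1) ω) ∂μ = ∫ ω, transfer a b c d f (U n ω) ∂μ := by
  simpa using hU.setIntegral_succ f n hf Set.univ

end integral

variable {S : ℕ}

lemma ae_fst_add_snd_eq (hU : IsUrnProcess a b c d u₀ U μ) (hab : a + b = S) (hcd : c + d = S)
    (n : ℕ) : ∀ᵐ ω ∂μ, (U n ω).1 + (U n ω).2 = u₀.1 + u₀.2 + n * S := by
  induction n with
  | zero => filter_upwards [hU.init] with ω h using by simp [h]
  | succ n ih =>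
    filter_upwards [ih, hU.ae_succ_eq n] with ω hn hsucc
    rw [add_one_mul]
    rcases hsucc with h | h <;> simp only [h, Prod.fst_add, Prod.snd_add] <;> omega

lemma ae_weight_eq (hU : IsUrnProcess a b c d u₀ U μ) (hab : a + b = S) (hcd : c + d = S)
    (hS : S ≠ 0) (n : ℕ) : ∀ᵐ ω ∂μ, weight S (U n ω) = weight S u₀ + n := by
  filter_upwards [hU.ae_fst_add_snd_eq hab hcd n] with ω hω
  have hS' : (S : ℝ) ≠ 0 := by exact_mod_cast hS
  rw [weight, weight, div_add' _ _ _ hS']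
  exact_mod_cast congrArg (fun N : ℕ => (N : ℝ) / S) hω

lemma integrable_comp (hU : IsUrnProcess a b c d u₀ U μ) (hab : a + b = S) (hcd : c + d = S)
    {E : Type*} [NormedAddCommGroup E] (f : ℕ × ℕ → E) (n : ℕ) :
    Integrable (fun ω => f (U n ω)) μ := by
  let N := u₀.1 + u₀.2 + n * S + 1
  refine Integrable.of_bound (C := ∑ u ∈ Finset.range N ×ˢ Finset.range N, ‖f u‖)
    (StronglyMeasurable.of_discrete.comp_measurable (hU.measurable n)).aestronglyMeasurable ?_
  filter_upwards [hU.ae_fst_add_snd_eq hab hcd n] with ω hω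
  refine Finset.single_le_sum (f := fun u => ‖f u‖) (fun u _ => norm_nonneg _) ?_
  rw [Finset.mem_product, Finset.mem_range, Finset.mem_range]
  omega

theorem integral_comp {μ : Measure Ω} [IsProbabilityMeasure μ]
    (hU : IsUrnProcess a b c d u₀ U μ) (hab : a + b = S) (hcd : c + d = S) {E : Type*}
    [NormedAddCommGroup E] [NormedSpace ℝ E] [CompleteSpace E] (f : ℕ × ℕ → E) (n : ℕ) :
    ∫ ω, f (U n ω) ∂μ = (transfer a b c d)^[n] f u₀ := by
  induction n generalizing f with
  | zero =>
    rw [integral_congr_ae (hU.init.mono fun ω h => congrArg f h)]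
    simp
  | succ n ih =>
    rw [hU.integral_succ f n (hU.integrable_comp hab hcd f _), ih, Function.iterate_succ_apply]

end IsUrnProcess

section growth

/-- The growth factor of the mean of `u₂` up to time `n` for an urn of initial weight `s`, which
is the ratio of `(s + σ)ₙ` to `(s)ₙ`. -/
def growth (s σ : ℝ) (n : ℕ) : ℝ :=
  (ascPochhammer ℝ n).eval (s + σ) / (ascPochhammer ℝ n).eval s

variable {s σ : ℝ}

lemma growth_zero : growth s σ 0 = 1 := by simp [growth]

lemma growth_succ (hs : 0 < s) (n : ℕ) :
    growth s σ (n + 1) = growth s σ n * (1 + σ / (s + n)) := by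
  have hsn : s + n ≠ 0 := by positivity
  rw [growth, growth, ascPochhammer_succ_eval, ascPochhammer_succ_eval, mul_div_mul_comm,
    add_right_comm s σ, add_div, div_self hsn]

lemma growth_pos (hs : 0 < s) (hσ : 0 ≤ σ) (n : ℕ) : 0 < growth s σ n :=
  div_pos (ascPochhammer_pos n _ (by positivity)) (ascPochhammer_pos n _ hs)

lemma ascPochhammer_eval_eq_prod_range (n : ℕ) (s : ℝ) :
    (ascPochhammer ℝ n).eval s = ∏ j ∈ Finset.range n, (s + j) := by
  induction n with
  | zero => simp
  | succ n ih => rw [ascPochhammer_succ_eval, ih, Finset.prod_range_succ]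

lemma growth_succ_div_rpow {n : ℕ} (hn : n ≠ 0) :
    growth s σ (n + 1) / (n : ℝ) ^ σ = Real.GammaSeq s n / Real.GammaSeq (s + σ) n := by
  have hn' : (0 : ℝ) < n := by exact_mod_cast Nat.pos_of_ne_zero hn
  have hs : (n : ℝ) ^ s ≠ 0 := (Real.rpow_pos_of_pos hn' s).ne'
  have hfact : (n.factorial : ℝ) ≠ 0 := by exact_mod_cast n.factorial_ne_zero
  rw [growth, Real.GammaSeq, Real.GammaSeq, ← ascPochhammer_eval_eq_prod_range,
    ← ascPochhammer_eval_eq_prod_range, Real.rpow_add hn', mul_right_comm, div_div_div_comm,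
    div_mul_cancel_left₀ (mul_ne_zero hs hfact), div_div_eq_mul_div, inv_mul_eq_div,
    div_right_comm]

theorem tendsto_growth_div_rpow (hs : 0 < s) (hσ : 0 ≤ σ) :
    Tendsto (fun n : ℕ => growth s σ n / (n : ℝ) ^ σ) atTop
      (𝓝 (Real.Gamma s / Real.Gamma (s + σ))) := by
  have hΓ : Real.Gamma (s + σ) ≠ 0 := (Real.Gamma_pos_of_pos (by positivity)).ne'
  have hfactor : Tendsto (fun n : ℕ => 1 + σ / (s + n)) atTop (𝓝 1) := by
    simpa using tendsto_const_nhds.add (tendsto_const_nhds.div_atTop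
      (tendsto_atTop_add_const_left _ s (tendsto_natCast_atTop_atTop (R := ℝ))))
  have hquot := ((Real.GammaSeq_tendsto_Gamma s).div (Real.GammaSeq_tendsto_Gamma (s + σ))
    hΓ).div hfactor one_ne_zero
  rw [div_one] at hquot
  refine hquot.congr' ?_
  filter_upwards [eventually_ne_atTop 0] with n hn
  have hfactor_ne : 1 + σ / (s + n) ≠ 0 := by positivity
  simp only [Pi.div_apply]
  rw [← growth_succ_div_rpow hn, growth_succ hs, div_right_comm, mul_div_cancel_right₀ _ hfactor_ne]

lemma summable_one_div_growth_sq (hs : 0 < s) (hσ : 1 / 2 < σ) :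
    Summable fun n => 1 / growth s σ n ^ 2 := by
  have hσ' : 0 ≤ σ := by linarith
  have hΓ : Real.Gamma s / Real.Gamma (s + σ) ≠ 0 :=
    (div_pos (Real.Gamma_pos_of_pos hs) (Real.Gamma_pos_of_pos (by positivity))).ne'
  refine summable_of_isBigO_nat (Real.summable_one_div_nat_rpow (p := 2 * σ) |>.2 (by linarith))
    (Asymptotics.isBigO_of_div_tendsto_nhds_of_ne_zero
      (((tendsto_growth_div_rpow hs hσ').pow 2).congr fun n => ?_) (pow_ne_zero 2 hΓ))
  rw [div_pow, ← Real.rpow_mul_natCast n.cast_nonneg, one_div, one_div, div_inv_eq_mul,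
    inv_mul_eq_div, mul_comm 2, Nat.cast_ofNat]

end growth

section eigenform

variable {a b c d S : ℕ}

lemma u₂_add (u v : ℕ × ℕ) : u₂ b c S (u + v) = u₂ b c S u + u₂ b c S v := by
  simp only [u₂, Prod.fst_add, Prod.snd_add, Nat.cast_add]
  ring

lemma transfer_u₂ (hab : a + b = S) (hcd : c + d = S) (u : ℕ × ℕ) :
    transfer a b c d (u₂ b c S) u = (1 + ratio a c S / weight S u) * u₂ b c S u := by
  rcases eq_or_ne S 0 with rfl | hS
  · simp [transfer, u₂]
  rcases eq_or_ne u 0 with rfl | hu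
  · simp [transfer, u₂]
  have hS' : (S : ℝ) ≠ 0 := by exact_mod_cast hS
  have hballs : (u.1 : ℝ) + u.2 ≠ 0 := (div_ne_zero_iff.1 (weight_pos hS hu).ne').1
  have hb : (b : ℝ) = S - a := by rw [← hab]; push_cast; ring
  have hd : (d : ℝ) = S - c := by rw [← hcd]; push_cast; ring
  rw [transfer, u₂_add, u₂_add]
  simp only [smul_eq_mul, u₂, weight, ratio, hb, hd]
  field_simp
  ring

lemma transfer_u₂_sq_le (hab : a + b = S) (hcd : c + d = S) (u : ℕ × ℕ) :
    transfer a b c d (fun v => u₂ b c S v ^ 2) u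
      ≤ (1 + ratio a c S / weight S u) ^ 2 * u₂ b c S u ^ 2
        + (u₂ b c S (a, b) ^ 2 + u₂ b c S (c, d) ^ 2) := by
  rcases eq_or_ne ((u.1 : ℝ) + u.2) 0 with hballs | hballs
  · simp only [transfer, hballs, div_zero, zero_smul, add_zero]
    positivity
  have hmean := transfer_u₂ hab hcd u
  simp only [transfer, u₂_add, smul_eq_mul] at hmean ⊢
  rw [← mul_pow, ← hmean]
  have hx : 0 ≤ (u.1 : ℝ) / (u.1 + u.2) := by positivity
  have hy : 0 ≤ (u.2 : ℝ) / (u.1 + u.2) := by positivity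
  have hxy : (u.2 : ℝ) / (u.1 + u.2) = 1 - u.1 / (u.1 + u.2) := by field_simp; ring
  generalize (u.1 : ℝ) / (u.1 + u.2) = x at *
  generalize (u.2 : ℝ) / (u.1 + u.2) = y at *
  generalize u₂ b c S u = w, u₂ b c S (a, b) = p, u₂ b c S (c, d) = q
  subst hxy
  have hvariance : x * (w + p) ^ 2 + (1 - x) * (w + q) ^ 2
      = (x * (w + p) + (1 - x) * (w + q)) ^ 2 + x * (1 - x) * (p - q) ^ 2 := by ring
  have hsmall : x * (1 - x) * (p - q) ^ 2 ≤ p ^ 2 + q ^ 2 := by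
    have hx1 : 0 ≤ x * (1 - x) := mul_nonneg hx hy
    nlinarith [mul_nonneg hx1 (sq_nonneg (p + q)),
      mul_nonneg (sq_nonneg (2 * x - 1)) (add_nonneg (sq_nonneg p) (sq_nonneg q))]
  rw [hvariance]
  exact add_le_add_right hsmall _

end eigenform

section convergence

variable {Ω : Type*} {m0 : MeasurableSpace Ω} {μ : Measure Ω} [IsProbabilityMeasure μ]

lemma eLpNorm_one_le_of_integral_sq_le {f : Ω → ℝ} (hf : Integrable f μ)
    (hsq : Integrable (fun ω => f ω ^ 2) μ) {R : ℝ} (hR : ∫ ω, f ω ^ 2 ∂μ ≤ R) :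
    eLpNorm f 1 μ ≤ ENNReal.ofReal (1 + R) := by
  rw [eLpNorm_one_eq_lintegral_enorm, ← ofReal_integral_norm_eq_lintegral_enorm hf]
  refine ENNReal.ofReal_le_ofReal ?_
  calc ∫ ω, ‖f ω‖ ∂μ ≤ ∫ ω, (1 + f ω ^ 2) ∂μ := by
        refine integral_mono hf.norm ((integrable_const _).add hsq) fun ω => ?_
        simp only [Real.norm_eq_abs]
        nlinarith [sq_abs (f ω), sq_nonneg (|f ω| - 1)]
    _ ≤ 1 + R := by
        rw [integral_add (integrable_const _) hsq]
        simpa using hR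

lemma ae_exists_tendsto_of_integral_sq_le {ℱ : Filtration ℕ m0} {M : ℕ → Ω → ℝ}
    (hM : Martingale M ℱ μ) (hsq : ∀ n, Integrable (fun ω => M n ω ^ 2) μ) {R : ℝ}
    (hR : ∀ n, ∫ ω, M n ω ^ 2 ∂μ ≤ R) :
    ∀ᵐ ω ∂μ, ∃ x, Tendsto (fun n => M n ω) atTop (𝓝 x) :=
  hM.submartingale.exists_ae_tendsto_of_bdd (R := (1 + R).toNNReal) fun n =>
    eLpNorm_one_le_of_integral_sq_le (hM.integrable n) (hsq n) (hR n)

end convergence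

/-- The eigenform `u₂` along the urn, rescaled by the growth factor of its mean. -/
def urnMartingale {Ω : Type*} (a b c S : ℕ) (u₀ : ℕ × ℕ) (U : ℕ → Ω → ℕ × ℕ) (n : ℕ) (ω : Ω) :
    ℝ :=
  u₂ b c S (U n ω) / growth (weight S u₀) (ratio a c S) n

namespace IsUrnProcess

variable {Ω : Type*} [MeasurableSpace Ω] {μ : Measure Ω} {a b c d S : ℕ} {u₀ : ℕ × ℕ}
  {U : ℕ → Ω → ℕ × ℕ}

theorem martingale_urnMartingale [IsFiniteMeasure μ] (hU : IsUrnProcess a b c d u₀ U μ)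
    (hab : a + b = S) (hcd : c + d = S) (hS : S ≠ 0) (hu₀ : u₀ ≠ 0) (hσ : 0 ≤ ratio a c S) :
    Martingale (urnMartingale a b c S u₀ U)
      (Filtration.natural U fun n => (hU.measurable n).stronglyMeasurable) μ := by
  have hw := weight_pos hS hu₀
  refine martingale_of_setIntegral_eq_succ (fun n => ?_)
    (fun n => (hU.integrable_comp hab hcd (u₂ b c S) n).div_const _) fun n s hs => ?_
  · have hadapted := (Filtration.stronglyAdapted_natural
      (fun i => (hU.measurable i).stronglyMeasurable) n).measurable
    exact (((measurable_of_countable (u₂ b c S)).comp hadapted).div_const _).stronglyMeasurable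
  rw [Filtration.natural_eq_comap] at hs
  obtain ⟨A, -, rfl⟩ := hs
  change ∫ ω in history U n ⁻¹' A, _ ∂μ = ∫ ω in history U n ⁻¹' A, _ ∂μ
  have hmean : ∫ ω in history U n ⁻¹' A, transfer a b c d (u₂ b c S) (U n ω) ∂μ
      = (1 + ratio a c S / (weight S u₀ + n)) * ∫ ω in history U n ⁻¹' A, u₂ b c S (U n ω) ∂μ := by
    rw [← integral_const_mul]
    refine integral_congr_ae (ae_restrict_of_ae ?_)
    filter_upwards [hU.ae_weight_eq hab hcd hS n] with ω hω
    rw [transfer_u₂ hab hcd, hω]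
  have hfactor : 1 + ratio a c S / (weight S u₀ + n) ≠ 0 := by positivity
  simp only [urnMartingale]
  rw [integral_div, integral_div, hU.setIntegral_succ _ _ (hU.integrable_comp hab hcd _ _), hmean,
    growth_succ hw, mul_comm (growth _ _ _), mul_div_mul_left _ _ hfactor]

variable [IsProbabilityMeasure μ]

lemma integral_u₂_sq_succ_le (hU : IsUrnProcess a b c d u₀ U μ) (hab : a + b = S)
    (hcd : c + d = S) (hS : S ≠ 0) (n : ℕ) :
    ∫ ω, u₂ b c S (U (n + 1) ω) ^ 2 ∂μ
      ≤ (1 + ratio a c S / (weight S u₀ + n)) ^ 2 * ∫ ω, u₂ b c S (U n ω) ^ 2 ∂μ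
        + (u₂ b c S (a, b) ^ 2 + u₂ b c S (c, d) ^ 2) := by
  have hint (n : ℕ) := hU.integrable_comp hab hcd (fun v => u₂ b c S v ^ 2) n
  calc _ = ∫ ω, transfer a b c d (fun v => u₂ b c S v ^ 2) (U n ω) ∂μ :=
        hU.integral_succ (fun v => u₂ b c S v ^ 2) n (hint (n + 1))
    _ ≤ ∫ ω, ((1 + ratio a c S / (weight S u₀ + n)) ^ 2 * u₂ b c S (U n ω) ^ 2
          + (u₂ b c S (a, b) ^ 2 + u₂ b c S (c, d) ^ 2)) ∂μ := by
        refine integral_mono_ae (hU.integrable_comp hab hcd _ n)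
          (((hint n).const_mul _).add (integrable_const _)) ?_
        filter_upwards [hU.ae_weight_eq hab hcd hS n] with ω hω
        rw [← hω]
        exact transfer_u₂_sq_le hab hcd _
    _ = _ := by
        rw [integral_add ((hint n).const_mul _) (integrable_const _), integral_const_mul]
        simp

lemma integral_urnMartingale_sq_le (hU : IsUrnProcess a b c d u₀ U μ) (hab : a + b = S)
    (hcd : c + d = S) (hS : S ≠ 0) (hu₀ : u₀ ≠ 0) (hσ : 0 ≤ ratio a c S) (n : ℕ) :
    ∫ ω, urnMartingale a b c S u₀ U n ω ^ 2 ∂μ ≤ u₂ b c S u₀ ^ 2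
      + (u₂ b c S (a, b) ^ 2 + u₂ b c S (c, d) ^ 2) *
        ∑ j ∈ Finset.range (n + 1), 1 / growth (weight S u₀) (ratio a c S) j ^ 2 := by
  have hw := weight_pos hS hu₀
  simp only [urnMartingale, div_pow, integral_div]
  induction n with
  | zero =>
    rw [integral_congr_ae (hU.init.mono fun ω h => congrArg (fun v => u₂ b c S v ^ 2) h)]
    simp only [integral_const, probReal_univ, one_smul, growth_zero, one_pow, div_one,
      zero_add, Finset.sum_range_one, mul_one]
    exact le_add_of_nonneg_right (by positivity)
  | succ n ih =>
    have hfactor : 1 + ratio a c S / (weight S u₀ + n) ≠ 0 := by positivity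
    rw [Finset.sum_range_succ, mul_add, ← add_assoc, mul_one_div]
    refine le_trans ?_ (add_le_add_left ih _)
    calc _ ≤ _ := div_le_div_of_nonneg_right (hU.integral_u₂_sq_succ_le hab hcd hS n)
          (sq_nonneg _)
      _ = _ := by
          rw [add_div]
          congr 1
          rw [growth_succ hw, mul_pow, mul_comm (growth _ _ _ ^ 2),
            mul_div_mul_left _ _ (pow_ne_zero 2 hfactor)]

theorem ae_exists_tendsto_normalized (hU : IsUrnProcess a b c d u₀ U μ) (hab : a + b = S)
    (hcd : c + d = S) (hS : S ≠ 0) (hu₀ : u₀ ≠ 0) (hσ : 1 / 2 < ratio a c S) :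
    ∀ᵐ ω ∂μ, ∃ x, Tendsto (fun n => normalized a b c S U n ω) atTop (𝓝 x) := by
  have hw := weight_pos hS hu₀
  have hσ' : 0 ≤ ratio a c S := by linarith
  have hsummable := summable_one_div_growth_sq hw hσ
  have hconv := ae_exists_tendsto_of_integral_sq_le
    (hU.martingale_urnMartingale hab hcd hS hu₀ hσ')
    (fun n => hU.integrable_comp hab hcd
      (fun v => (u₂ b c S v / growth (weight S u₀) (ratio a c S) n) ^ 2) n)
    (fun n => (hU.integral_urnMartingale_sq_le hab hcd hS hu₀ hσ' n).trans
      (add_le_add_right (mul_le_mul_of_nonneg_left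
        (hsummable.sum_le_tsum _ fun j _ => by positivity) (by positivity)) _))
  filter_upwards [hconv] with ω ⟨x, hx⟩
  refine ⟨_, (hx.mul (tendsto_growth_div_rpow hw hσ')).congr fun n => ?_⟩
  exact div_mul_div_cancel₀ (growth_pos hw hσ' n).ne'

lemma ae_tendsto_limitW (hU : IsUrnProcess a b c d u₀ U μ) (hab : a + b = S)
    (hcd : c + d = S) (hS : S ≠ 0) (hu₀ : u₀ ≠ 0) (hσ : 1 / 2 < ratio a c S) :
    ∀ᵐ ω ∂μ, Tendsto (fun n => normalized a b c S U n ω) atTop (𝓝 (limitW a b c S U ω)) := by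
  filter_upwards [hU.ae_exists_tendsto_normalized hab hcd hS hu₀ hσ] with ω hω
  exact tendsto_nhds_limUnder hω

end IsUrnProcess

section limitLaw

variable {a b c d S : ℕ}

/-- The character `u ↦ exp (i t u₂ u)`, whose mean along the urn is the characteristic function of
`u₂`. -/
def u₂Char (b c S : ℕ) (t : ℝ) : AddChar (ℕ × ℕ) ℂ where
  toFun u := Complex.exp ((t * u₂ b c S u : ℝ) * Complex.I)
  map_zero_eq_one' := by simp [u₂]
  map_add_eq_mul' u v := by
    rw [← Complex.exp_add, ← add_mul, ← Complex.ofReal_add, ← mul_add, u₂_add]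

lemma u₂Char_apply (t : ℝ) (u : ℕ × ℕ) :
    u₂Char b c S t u = Complex.exp ((t * u₂ b c S u : ℝ) * Complex.I) := rfl

lemma norm_iterate_transfer_u₂Char_le (t : ℝ) (n : ℕ) (u : ℕ × ℕ) :
    ‖(transfer a b c d)^[n] (u₂Char b c S t) u‖ ≤ 1 :=
  norm_iterate_transfer_le (fun _ => (Complex.norm_exp_ofReal_mul_I _).le) n u

/-- `ρ` is the limit law of `u₂ (U n) / n ^ σ` for the urn `U` started from `u`. It is expressed
by convergence of characteristic functions, with a parameter that may vary with `n`. -/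
def IsLimitLaw (a b c d S : ℕ) (u : ℕ × ℕ) (ρ : Measure ℝ) : Prop :=
  ∀ t, Tendsto (fun p : ℕ × ℝ =>
      (transfer a b c d)^[p.1] (u₂Char b c S (p.2 / (p.1 : ℝ) ^ ratio a c S)) u)
    (atTop ×ˢ 𝓝 t) (𝓝 (charFun ρ t))

lemma tendsto_iterate_transfer_u₂Char_proportionFilter {ι : Type*} {v : ι → ℝ} {k : ι}
    (hk : 0 < v k) {u : ℕ × ℕ} {ρ : Measure ℝ} (hρ : IsLimitLaw a b c d S u ρ) (t : ℝ) :
    Tendsto (fun p : ℕ × (ι → ℕ) =>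
        (transfer a b c d)^[p.2 k] (u₂Char b c S (t / (p.1 : ℝ) ^ ratio a c S)) u)
      (proportionFilter v) (𝓝 (charFun ρ (t * v k ^ ratio a c S))) := by
  have hparam : Tendsto (fun p : ℕ × (ι → ℕ) => t * ((p.2 k : ℝ) / p.1) ^ ratio a c S)
      (proportionFilter v) (𝓝 (t * v k ^ ratio a c S)) :=
    ((tendsto_proportion k).rpow_const (Or.inl hk.ne')).const_mul t
  refine ((hρ _).comp ((tendsto_apply_proportionFilter hk).prodMk hparam)).congr' ?_
  filter_upwards [(tendsto_apply_proportionFilter hk).eventually_gt_atTop 0] with p hp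
  have hpow : (p.2 k : ℝ) ^ ratio a c S ≠ 0 := (Real.rpow_pos_of_pos (by exact_mod_cast hp) _).ne'
  simp only [Function.comp_apply]
  rw [Real.div_rpow (Nat.cast_nonneg _) (Nat.cast_nonneg _), ← mul_div_assoc, div_right_comm,
    mul_div_cancel_right₀ _ hpow]

/-- The urn started from `∑ k, u k` is a superposition of independent urns started from the `u k`
which receive random proportions `v k` of the draws. -/
theorem tendsto_iterate_transfer_u₂Char_sum (hab : a + b = S) (hcd : c + d = S) (hS : S ≠ 0)
    {m : ℕ} {u : Fin (m + 1) → ℕ × ℕ} (hu : ∀ k, u k ≠ 0) {ρ : Fin (m + 1) → Measure ℝ}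
    (hρ : ∀ k, IsLimitLaw a b c d S (u k) (ρ k)) (t : ℝ) :
    Tendsto (fun n : ℕ =>
        (transfer a b c d)^[n] (u₂Char b c S (t / (n : ℝ) ^ ratio a c S)) (∑ k, u k)) atTop
      (𝓝 (∫ v, ∏ k, charFun (ρ k) (t * v k ^ ratio a c S)
        ∂dirichletMeasure fun k => weight S (u k))) := by
  have := isProbabilityMeasure_dirichletMeasure fun k => weight_pos hS (hu k)
  have hbound (n : ℕ) (l : Fin (m + 1) → ℕ) : ‖∏ k, (transfer a b c d)^[l k]
      (u₂Char b c S (t / (n : ℝ) ^ ratio a c S)) (u k)‖ ≤ 1 := by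
    rw [norm_prod]
    exact Finset.prod_le_one (fun k _ => norm_nonneg _) fun k _ =>
      norm_iterate_transfer_u₂Char_le _ _ _
  simp only [iterate_transfer_sum_eq_integral_dirichletMeasure hab hcd hS _ hu]
  refine tendsto_integral_of_dominated_convergence (fun _ => 1) (fun n => ?_)
    (integrable_const _) (fun n => ?_) ?_
  · simp only [multinomialWeight]
    exact Continuous.aestronglyMeasurable (by fun_prop)
  · filter_upwards [ae_pos_dirichletMeasure _, ae_sum_dirichletMeasure _] with v hpos hsum
    simpa only [zero_mul, add_zero] using norm_sum_multinomialWeight_smul_le (B := 0)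
      (fun k => (hpos k).le) hsum le_rfl fun l => by
        simpa only [zero_mul, add_zero] using hbound n l
  · filter_upwards [ae_pos_dirichletMeasure _, ae_sum_dirichletMeasure _] with v hpos hsum
    exact tendsto_sum_multinomialWeight_smul (fun k => (hpos k).le) hsum hbound
      (tendsto_finsetProd _ fun k _ =>
        tendsto_iterate_transfer_u₂Char_proportionFilter (hpos k) (hρ k) t)

lemma IsLimitLaw.tendsto_iterate_transfer_succ {u : ℕ × ℕ} {ρ : Measure ℝ}
    (hρ : IsLimitLaw a b c d S u ρ) (t : ℝ) :
    Tendsto (fun n : ℕ =>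
        (transfer a b c d)^[n + 1] (u₂Char b c S (t / (n : ℝ) ^ ratio a c S)) u) atTop
      (𝓝 (charFun ρ t)) := by
  have hquot : Tendsto (fun n : ℕ => ((n + 1 : ℕ) : ℝ) / n) atTop (𝓝 1) := by
    simpa using (tendsto_natCast_div_add_atTop (1 : ℝ)).inv₀ one_ne_zero
  have hparam : Tendsto (fun n : ℕ => t * (((n + 1 : ℕ) : ℝ) / n) ^ ratio a c S) atTop (𝓝 t) := by
    simpa using (hquot.rpow_const (p := ratio a c S) (Or.inl one_ne_zero)).const_mul t
  refine ((hρ t).comp ((tendsto_add_atTop_nat 1).prodMk hparam)).congr fun n => ?_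
  have hpow : ((n + 1 : ℕ) : ℝ) ^ ratio a c S ≠ 0 := by positivity
  simp only [Function.comp_apply]
  rw [Real.div_rpow (Nat.cast_nonneg _) (Nat.cast_nonneg _), ← mul_div_assoc, div_right_comm,
    mul_div_cancel_right₀ _ hpow]

theorem IsLimitLaw.charFun_eq_integral_of_transfer_eq (hab : a + b = S) (hcd : c + d = S)
    (hS : S ≠ 0) {u₀ : ℕ × ℕ} {ρ₀ : Measure ℝ} (hρ₀ : IsLimitLaw a b c d S u₀ ρ₀) {m : ℕ}
    {u : Fin (m + 1) → ℕ × ℕ} (hu : ∀ k, u k ≠ 0) {ρ : Fin (m + 1) → Measure ℝ}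
    (hρ : ∀ k, IsLimitLaw a b c d S (u k) (ρ k))
    (hstep : ∀ f : ℕ × ℕ → ℂ, transfer a b c d f u₀ = f (∑ k, u k)) (t : ℝ) :
    charFun ρ₀ t = ∫ v, ∏ k, charFun (ρ k) (t * v k ^ ratio a c S)
      ∂dirichletMeasure fun k => weight S (u k) := by
  refine tendsto_nhds_unique (hρ₀.tendsto_iterate_transfer_succ t) ?_
  simpa only [Function.iterate_succ_apply', hstep] using
    tendsto_iterate_transfer_u₂Char_sum hab hcd hS hu hρ t

end limitLaw

lemma charFun_map_eq_integral_exp {Ω : Type*} [MeasurableSpace Ω] {μ : Measure Ω} {W : Ω → ℝ}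
    (hW : AEMeasurable W μ) (t : ℝ) :
    charFun (μ.map W) t = ∫ ω, Complex.exp ((t * W ω : ℝ) * Complex.I) ∂μ := by
  rw [charFun_apply_real, integral_map hW (Measurable.aestronglyMeasurable (by fun_prop))]
  simp only [Complex.ofReal_mul]

namespace IsUrnProcess

variable {Ω : Type*} [MeasurableSpace Ω] {μ : Measure Ω} {a b c d S : ℕ} {u₀ : ℕ × ℕ}
  {U : ℕ → Ω → ℕ × ℕ} {W : Ω → ℝ}

lemma measurable_normalized (hU : IsUrnProcess a b c d u₀ U μ) (n : ℕ) :
    Measurable (normalized a b c S U n) :=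
  ((measurable_of_countable (u₂ b c S)).comp (hU.measurable n)).div_const _

lemma aemeasurable_of_tendsto_normalized (hU : IsUrnProcess a b c d u₀ U μ)
    (hW : ∀ᵐ ω ∂μ, Tendsto (fun n => normalized a b c S U n ω) atTop (𝓝 (W ω))) :
    AEMeasurable W μ :=
  aemeasurable_of_tendsto_metrizable_ae atTop (fun n => (hU.measurable_normalized n).aemeasurable)
    hW

theorem isLimitLaw_map [IsProbabilityMeasure μ] (hU : IsUrnProcess a b c d u₀ U μ)
    (hab : a + b = S) (hcd : c + d = S)
    (hW : ∀ᵐ ω ∂μ, Tendsto (fun n => normalized a b c S U n ω) atTop (𝓝 (W ω))) :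
    IsLimitLaw a b c d S u₀ (μ.map W) := by
  intro t
  have hexp : Continuous fun x : ℝ => Complex.exp (x * Complex.I) := by fun_prop
  simp only [← hU.integral_comp hab hcd, u₂Char_apply,
    charFun_map_eq_integral_exp (hU.aemeasurable_of_tendsto_normalized hW), div_mul_eq_mul_div,
    mul_div_assoc]
  refine tendsto_integral_filter_of_dominated_convergence (fun _ => 1) (.of_forall fun p => ?_)
    (.of_forall fun p => .of_forall fun ω => (Complex.norm_exp_ofReal_mul_I _).le)
    (integrable_const _) ?_
  · exact (hexp.measurable.comp
      ((hU.measurable_normalized p.1).const_mul p.2)).aestronglyMeasurable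
  · filter_upwards [hW] with ω hω
    exact (hexp.tendsto _).comp (tendsto_snd.mul (hω.comp tendsto_fst))

end IsUrnProcess

section independentWeights

variable {Ω ι : Type*} [MeasurableSpace Ω] {P : Measure Ω} [IsProbabilityMeasure P] [Fintype ι]

lemma integral_exp_sum_mul_pi {ρ : ι → Measure ℝ} [∀ k, SigmaFinite (ρ k)] (a : ι → ℝ) (t : ℝ) :
    ∫ z, Complex.exp ((t * ∑ k, a k * z k : ℝ) * Complex.I) ∂Measure.pi ρ
      = ∏ k, charFun (ρ k) (t * a k) := by
  have hexp (z : ι → ℝ) : Complex.exp ((t * ∑ k, a k * z k : ℝ) * Complex.I)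
      = ∏ k, Complex.exp ((t * a k : ℝ) * z k * Complex.I) := by
    rw [← Complex.exp_sum, ← Finset.sum_mul, Finset.mul_sum]
    push_cast
    simp only [mul_assoc]
  simp only [hexp, charFun_apply_real]
  exact integral_fintype_prod_eq_prod
    (fun k (x : ℝ) => Complex.exp ((t * a k : ℝ) * x * Complex.I))

theorem charFun_map_sum_mul_eq_integral {A : Ω → ι → ℝ} {Z : ι → Ω → ℝ}
    (hA : AEMeasurable A P) (hZ : ∀ k, AEMeasurable (Z k) P) (hindep : iIndepFun Z P)
    (hAZ : IndepFun A (fun ω k => Z k ω) P) (t : ℝ) :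
    charFun (P.map fun ω => ∑ k, A ω k * Z k ω) t
      = ∫ a, ∏ k, charFun (P.map (Z k)) (t * a k) ∂P.map A := by
  have hZ' : AEMeasurable (fun ω k => Z k ω) P := aemeasurable_pi_lambda _ hZ
  have := Measure.isProbabilityMeasure_map hA
  have (k : ι) := Measure.isProbabilityMeasure_map (hZ k)
  have hjoint : P.map (fun ω => (A ω, fun k => Z k ω))
      = (P.map A).prod (Measure.pi fun k => P.map (Z k)) := by
    rw [(indepFun_iff_map_prod_eq_prod_map_map hA hZ').1 hAZ,
      (iIndepFun_iff_map_fun_eq_pi_map hZ).1 hindep]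
  have hsum : Measurable fun p : (ι → ℝ) × (ι → ℝ) => ∑ k, p.1 k * p.2 k := by fun_prop
  have hexp : StronglyMeasurable fun p : (ι → ℝ) × (ι → ℝ) =>
      Complex.exp ((t * ∑ k, p.1 k * p.2 k : ℝ) * Complex.I) :=
    Measurable.stronglyMeasurable (by fun_prop)
  calc charFun (P.map fun ω => ∑ k, A ω k * Z k ω) t
      = ∫ ω, Complex.exp ((t * ∑ k, A ω k * Z k ω : ℝ) * Complex.I) ∂P :=
        charFun_map_eq_integral_exp (hsum.comp_aemeasurable (hA.prodMk hZ')) t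
    _ = ∫ p, Complex.exp ((t * ∑ k, p.1 k * p.2 k : ℝ) * Complex.I)
          ∂(P.map A).prod (Measure.pi fun k => P.map (Z k)) := by
        rw [← hjoint, integral_map (hA.prodMk hZ') hexp.aestronglyMeasurable]
    _ = ∫ a, ∏ k, charFun (P.map (Z k)) (t * a k) ∂P.map A := by
        rw [integral_prod _ (Integrable.of_bound hexp.aestronglyMeasurable 1
          (.of_forall fun _ => (Complex.norm_exp_ofReal_mul_I _).le))]
        simp only [integral_exp_sum_mul_pi]

end independentWeights

/-- The composition of the urn from which the `k`-th subtree grows: one red ball for `k < r`, one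
black ball otherwise. -/
def singleBall {n : ℕ} (r : ℕ) (k : Fin n) : ℕ × ℕ := if (k : ℕ) < r then (1, 0) else (0, 1)

lemma singleBall_ne_zero {n : ℕ} (r : ℕ) (k : Fin n) : singleBall r k ≠ 0 := by
  unfold singleBall
  split_ifs <;> simp

lemma weight_singleBall (S r : ℕ) {n : ℕ} (k : Fin n) : weight S (singleBall r k) = 1 / S := by
  unfold singleBall
  split_ifs <;> simp [weight]

lemma sum_singleBall {n r : ℕ} (hr : r ≤ n) : ∑ k : Fin n, singleBall r k = (r, n - r) := by
  have hred : ∑ k : Fin n, (singleBall r k).1 = r := by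
    simp [singleBall, apply_ite Prod.fst, Fin.card_filter_val_lt, hr]
  have htotal : ∑ k : Fin n, ((singleBall r k).1 + (singleBall r k).2) = n := by
    simp [singleBall, apply_ite Prod.fst, apply_ite Prod.snd, ite_add_ite]
  rw [Finset.sum_add_distrib, hred] at htotal
  ext
  · simpa only [Prod.fst_sum] using hred
  · simpa only [Prod.snd_sum] using Nat.eq_sub_of_add_eq' htotal

namespace IsCopyFamily

variable {Ω Ω₁ Ω₂ : Type*} [MeasurableSpace Ω] [MeasurableSpace Ω₁] [MeasurableSpace Ω₂]
  {S r : ℕ} {X : Ω₁ → ℝ} {μ₁ : Measure Ω₁} {Y : Ω₂ → ℝ} {μ₂ : Measure Ω₂}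
  {V : Ω → Fin (S + 1) → ℝ} {Z : Fin (S + 1) → Ω → ℝ} {P : Measure Ω}

lemma aemeasurable_copy (h : IsCopyFamily S r X μ₁ Y μ₂ V Z P) (k : Fin (S + 1)) :
    AEMeasurable (Z k) P := by
  rcases lt_or_ge (k : ℕ) r with hk | hk
  · exact (h.copy_X k hk).aemeasurable_fst
  · exact (h.copy_Y k hk).aemeasurable_fst

lemma aemeasurable_rpow (h : IsCopyFamily S r X μ₁ Y μ₂ V Z P) (σ : ℝ) :
    AEMeasurable (fun ω k => V ω k ^ σ) P :=
  (show Measurable fun (v : Fin (S + 1) → ℝ) k => v k ^ σ by fun_prop).comp_aemeasurable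
    h.law_V.aemeasurable

lemma isLimitLaw_copy {a b c d : ℕ} (h : IsCopyFamily S r X μ₁ Y μ₂ V Z P)
    (hX : IsLimitLaw a b c d S (1, 0) (μ₁.map X)) (hY : IsLimitLaw a b c d S (0, 1) (μ₂.map Y))
    (k : Fin (S + 1)) : IsLimitLaw a b c d S (singleBall r k) (P.map (Z k)) := by
  unfold singleBall
  split_ifs with hk
  · rwa [(h.copy_X k hk).map_eq]
  · rwa [(h.copy_Y k (not_lt.1 hk)).map_eq]

variable [IsProbabilityMeasure P]

lemma charFun_map_sum (h : IsCopyFamily S r X μ₁ Y μ₂ V Z P) (σ t : ℝ) :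
    charFun (P.map fun ω => ∑ k, V ω k ^ σ * Z k ω) t
      = ∫ v, ∏ k, charFun (P.map (Z k)) (t * v k ^ σ)
        ∂dirichletMeasure fun _ : Fin (S + 1) => 1 / (S : ℝ) := by
  have hpow : Measurable fun (v : Fin (S + 1) → ℝ) k => v k ^ σ := by fun_prop
  have (k : Fin (S + 1)) := Measure.isProbabilityMeasure_map (h.aemeasurable_copy k)
  have hprod : Continuous fun a : Fin (S + 1) → ℝ => ∏ k, charFun (P.map (Z k)) (t * a k) :=
    continuous_finsetProd _ fun k _ => continuous_charFun.comp (by fun_prop)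
  have hlawV : P.map (fun ω k => V ω k ^ σ)
      = (dirichletMeasure fun _ => 1 / (S : ℝ)).map fun v k => v k ^ σ := by
    rw [← h.law_V.map_eq]
    exact (AEMeasurable.map_map_of_aemeasurable hpow.aemeasurable h.law_V.aemeasurable).symm
  rw [charFun_map_sum_mul_eq_integral (h.aemeasurable_rpow σ) h.aemeasurable_copy h.indep_Z
    (h.indep_V.comp hpow measurable_id), hlawV]
  exact integral_map hpow.aemeasurable hprod.aestronglyMeasurable

theorem identDistrib_sum {a b c d : ℕ} (h : IsCopyFamily S r X μ₁ Y μ₂ V Z P) (hab : a + b = S)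
    (hcd : c + d = S) (hS : S ≠ 0) (hX : IsLimitLaw a b c d S (1, 0) (μ₁.map X))
    (hY : IsLimitLaw a b c d S (0, 1) (μ₂.map Y)) {Ω₀ : Type*} [MeasurableSpace Ω₀]
    {μ₀ : Measure Ω₀} [IsFiniteMeasure μ₀] {W : Ω₀ → ℝ} (hW : AEMeasurable W μ₀) {u₀ : ℕ × ℕ}
    (hlaw : IsLimitLaw a b c d S u₀ (μ₀.map W)) (hr : r ≤ S + 1)
    (hstep : ∀ f : ℕ × ℕ → ℂ, transfer a b c d f u₀ = f (r, S + 1 - r)) :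
    IdentDistrib W (fun ω => ∑ k, V ω k ^ ratio a c S * Z k ω) μ₀ P where
  aemeasurable_fst := hW
  aemeasurable_snd := Finset.aemeasurable_fun_sum _ fun k _ =>
    ((measurable_pi_apply k).comp_aemeasurable (h.aemeasurable_rpow _)).mul (h.aemeasurable_copy k)
  map_eq := by
    refine Measure.ext_of_charFun (funext fun t => ?_)
    rw [h.charFun_map_sum, hlaw.charFun_eq_integral_of_transfer_eq hab hcd hS
      (singleBall_ne_zero r) (h.isLimitLaw_copy hX hY) (by rwa [sum_singleBall hr]) t]
    simp only [weight_singleBall]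

end IsCopyFamily

section firstDraw

variable {E : Type*} [AddCommMonoid E] [Module ℝ E] {a b c d : ℕ} (f : ℕ × ℕ → E)

lemma transfer_one_zero : transfer a b c d f (1, 0) = f (a + 1, b) := by
  simp [transfer, add_comm]

lemma transfer_zero_one : transfer a b c d f (0, 1) = f (c, d + 1) := by
  simp [transfer, add_comm]

end firstDraw

end PolyaUrn

end

theorem mainTheorem7_general (a b c d S : ℕ) (hab : a + b = S) (hcd : c + d = S)
    (hσ : 1 / 2 < PolyaUrn.ratio a c S)
    {Ω₁ : Type*} [MeasurableSpace Ω₁] (μ₁ : Measure Ω₁) [IsProbabilityMeasure μ₁]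
    {Ω₂ : Type*} [MeasurableSpace Ω₂] (μ₂ : Measure Ω₂) [IsProbabilityMeasure μ₂]
    (U₁ : ℕ → Ω₁ → ℕ × ℕ) (hU₁ : PolyaUrn.IsUrnProcess a b c d (1, 0) U₁ μ₁)
    (U₂ : ℕ → Ω₂ → ℕ × ℕ) (hU₂ : PolyaUrn.IsUrnProcess a b c d (0, 1) U₂ μ₂)
    (X : Ω₁ → ℝ) (hX : X = PolyaUrn.limitW a b c S U₁)
    (Y : Ω₂ → ℝ) (hY : Y = PolyaUrn.limitW a b c S U₂) :
    (∀ᵐ ω ∂μ₁, Tendsto (fun n => PolyaUrn.normalized a b c S U₁ n ω) atTop (𝓝 (X ω))) ∧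
    (∀ᵐ ω ∂μ₂, Tendsto (fun n => PolyaUrn.normalized a b c S U₂ n ω) atTop (𝓝 (Y ω))) ∧
    (∀ (Ω : Type*) [MeasurableSpace Ω] (P : Measure Ω) [IsProbabilityMeasure P]
      (V : Ω → Fin (S + 1) → ℝ) (Z : Fin (S + 1) → Ω → ℝ),
      PolyaUrn.IsCopyFamily S (a + 1) X μ₁ Y μ₂ V Z P →
      IdentDistrib X (fun ω => ∑ k, V ω k ^ PolyaUrn.ratio a c S * Z k ω) μ₁ P) ∧
    (∀ (Ω : Type*) [MeasurableSpace Ω] (P : Measure Ω) [IsProbabilityMeasure P]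
      (V : Ω → Fin (S + 1) → ℝ) (Z : Fin (S + 1) → Ω → ℝ),
      PolyaUrn.IsCopyFamily S c X μ₁ Y μ₂ V Z P →
      IdentDistrib Y (fun ω => ∑ k, V ω k ^ PolyaUrn.ratio a c S * Z k ω) μ₂ P) := by
  have hS : S ≠ 0 := by
    rintro rfl
    norm_num [PolyaUrn.ratio] at hσ
  have hXlim := hU₁.ae_tendsto_limitW hab hcd hS (by simp) hσ
  have hYlim := hU₂.ae_tendsto_limitW hab hcd hS (by simp) hσ
  subst hX hY
  have hXlaw := hU₁.isLimitLaw_map hab hcd hXlim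
  have hYlaw := hU₂.isLimitLaw_map hab hcd hYlim
  refine ⟨hXlim, hYlim, fun Ω _ P _ V Z hcopies => ?_, fun Ω _ P _ V Z hcopies => ?_⟩
  · refine hcopies.identDistrib_sum hab hcd hS hXlaw hYlaw
      (hU₁.aemeasurable_of_tendsto_normalized hXlim) hXlaw (by omega) fun f => ?_
    rw [PolyaUrn.transfer_one_zero, show S + 1 - (a + 1) = b by omega]
  · refine hcopies.identDistrib_sum hab hcd hS hXlaw hYlaw
      (hU₂.aemeasurable_of_tendsto_normalized hYlim) hYlaw (by omega) fun f => ?_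
    rw [PolyaUrn.transfer_zero_one, show S + 1 - c = d + 1 by omega]

theorem mainTheorem7 (a b c d S : ℕ) (hab : a + b = S) (hcd : c + d = S)
    (hb : b ≠ 0) (hc : c ≠ 0) (hσ : 1 / 2 < PolyaUrn.ratio a c S)
    {Ω₁ : Type*} [MeasurableSpace Ω₁] (μ₁ : Measure Ω₁) [IsProbabilityMeasure μ₁]
    {Ω₂ : Type*} [MeasurableSpace Ω₂] (μ₂ : Measure Ω₂) [IsProbabilityMeasure μ₂]
    (U₁ : ℕ → Ω₁ → ℕ × ℕ) (hU₁ : PolyaUrn.IsUrnProcess a b c d (1, 0) U₁ μ₁)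
    (U₂ : ℕ → Ω₂ → ℕ × ℕ) (hU₂ : PolyaUrn.IsUrnProcess a b c d (0, 1) U₂ μ₂)
    (X : Ω₁ → ℝ) (hX : X = PolyaUrn.limitW a b c S U₁)
    (Y : Ω₂ → ℝ) (hY : Y = PolyaUrn.limitW a b c S U₂) :
    (∀ᵐ ω ∂μ₁, Tendsto (fun n => PolyaUrn.normalized a b c S U₁ n ω) atTop (𝓝 (X ω))) ∧
    (∀ᵐ ω ∂μ₂, Tendsto (fun n => PolyaUrn.normalized a b c S U₂ n ω) atTop (𝓝 (Y ω))) ∧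
    (∀ (Ω : Type*) [MeasurableSpace Ω] (P : Measure Ω) [IsProbabilityMeasure P]
      (V : Ω → Fin (S + 1) → ℝ) (Z : Fin (S + 1) → Ω → ℝ),
      PolyaUrn.IsCopyFamily S (a + 1) X μ₁ Y μ₂ V Z P →
      IdentDistrib X (fun ω => ∑ k, V ω k ^ PolyaUrn.ratio a c S * Z k ω) μ₁ P) ∧
    (∀ (Ω : Type*) [MeasurableSpace Ω] (P : Measure Ω) [IsProbabilityMeasure P]
      (V : Ω → Fin (S + 1) → ℝ) (Z : Fin (S + 1) → Ω → ℝ),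
      PolyaUrn.IsCopyFamily S c X μ₁ Y μ₂ V Z P →
      IdentDistrib Y (fun ω => ∑ k, V ω k ^ PolyaUrn.ratio a c S * Z k ω) μ₂ P) :=
  mainTheorem7_general a b c d S hab hcd hσ μ₁ μ₂ U₁ hU₁ U₂ hU₂ X hX Y hY
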